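/- Conventions. Work with stacks in groupoids on the site of topological spaces and open coverings; a space is regarded as a stack via the Yoneda embedding. A morphism of stacks $f:Y\to X$ is *representable* if for every space $T$ and every morphism $T\to X$ the ($2$-categorical) fibre product $T\times_X Y$ is equivalent to a space. An *atlas* of a stack $X$ is a morphism $a:A\to X$ from a space $A$ that is representable, surjective and admits local sections, i.e. for every space $T$ and every morphism $T\to X$ the projection of spaces $T\times_XA\to T$ is surjective and has continuous sections locally on $T$. An atlas gives rise to the topological groupoid $\mathcal A: A\times_XA\Rightarrow A$. For a topological groupoid $G:G^1\Rightarrow G^0$ with source and range $s,r:G^1\to G^0$ we say that - $G$ is *separated* if the identity map $\mathbf 1:G^0\to G^1$ is a closed map; - $G$ is *proper* if $(s,r):G^1\to G^0\times G^0$ is a proper (i.e. universally closed) map; - $G$ is *étale* if $s$ and $r$ are local homeomorphisms; - $G$ is *very proper* if it is proper and étale and there is a continuous function $\chi:G^0\to[0,1]$ such that $r:\operatorname{supp}(s^*\chi)\to G^0$ is proper and $\sum_{\gamma\in r^{-1}(x)}\chi(s(\gamma))=1$ for all $x\in G^0$. An *orbispace* is a stack $X$ that admits an atlas $A\to X$ such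 that $A\times_XA\Rightarrow A$ is very proper, étale and separated. A *morphism of orbispaces* is a representable morphism of stacks between orbispaces. The *loop (inertia) stack* $LX$ of a stack $X$ has as objects over a space $T$ the pairs $(u,\phi)$ of an object $u\in X(T)$ and an automorphism $\phi\in\operatorname{Aut}(u)$; a morphism $(u,\phi)\to(u',\phi')$ is a morphism $f:u\to u'$ in $X(T)$ with $f\circ\phi=\phi'\circ f$. The canonical morphism $LX\to X$ maps $(u,\phi)$ to $u$. Lemma. Let $X$ be an orbispace. Then the loop stack $LX$ is an orbispace, and the canonical morphism $LX\to X$ is a morphism of orbispaces, i.e. it is representable. -/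

import Mathlib

open CategoryTheory Bicategory Opposite Limits
open scoped CategoryTheory.Pseudofunctor.StrongTrans

universe u

namespace Orbispace

/-! ## Stacks in topological spaces -/

/-- A prestack on the site of topological spaces: a pseudofunctor `Topᵒᵖ ⥤ᵖ Cat`.
Morphisms of prestacks are the `1`-morphisms (strong transformations) of the bicategory of
pseudofunctors, and its `2`-morphisms are modifications. -/
abbrev Prestack : Type (u + 2) :=
  LocallyDiscrete TopCat.{u}ᵒᵖ ⥤ᵖ Cat.{u, u + 1}

/-- The space `U`, considered as an object of the source of a prestack. -/
abbrev site (U : TopCat.{u}) : LocallyDiscrete TopCat.{u}ᵒᵖ :=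
  LocallyDiscrete.mk (op U)

/-- A prestack is a stack in topological spaces if its values are groupoids and if it satisfies
descent for morphisms and for objects with respect to open coverings. -/
structure IsTopStack (X : Prestack.{u}) : Prop where
  isGroupoid (U : TopCat.{u}) : IsGroupoid (X.obj (site U))
  isStack : X.IsStack TopCat.grothendieckTopology.{u}

/-! ## Spaces as stacks -/

/-- The `U`-points of the space `A`: the continuous maps `U ⟶ A`. -/
structure Points (A U : TopCat.{u}) : Type (u + 1) where
  /-- The underlying continuous map. -/
  map : U ⟶ A

/-- The set of `U`-points is regarded as a discrete category. -/
instance (A U : TopCat.{u}) : Category.{u} (Points A U) where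
  Hom x y := ULift.{u} (PLift (x.map = y.map))
  id x := ⟨⟨rfl⟩⟩
  comp f g := ⟨⟨f.down.down.trans g.down.down⟩⟩

theorem Points.hom_subsingleton {A U : TopCat.{u}} (x y : Points A U) (f g : x ⟶ y) : f = g := by
  obtain ⟨⟨_⟩⟩ := f
  obtain ⟨⟨_⟩⟩ := g
  rfl

instance (A U : TopCat.{u}) (x y : Points A U) : Subsingleton (x ⟶ y) :=
  ⟨Points.hom_subsingleton x y⟩

/-- The (unique) morphism of points given by an equality of maps. -/
def Points.homMk {A U : TopCat.{u}} {x y : Points A U} (h : x.map = y.map) : x ⟶ y :=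
  ⟨⟨h⟩⟩

/-- The (unique) isomorphism of points given by an equality of maps. -/
def Points.isoMk {A U : TopCat.{u}} {x y : Points A U} (h : x.map = y.map) : x ≅ y where
  hom := Points.homMk h
  inv := Points.homMk h.symm
  hom_inv_id := Subsingleton.elim _ _
  inv_hom_id := Subsingleton.elim _ _

/-- Pull-back of points along a map `V ⟶ U`. -/
def Points.pullback (A : TopCat.{u}) {U V : TopCat.{u}} (g : V ⟶ U) : Points A U ⥤ Points A V where
  obj x := ⟨g ≫ x.map⟩
  map f := Points.homMk (congrArg (fun m => g ≫ m) f.down.down)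

/-- Push-forward of points along a map `A ⟶ B`. -/
def Points.pushforward {A B : TopCat.{u}} (f : A ⟶ B) (U : TopCat.{u}) :
    Points A U ⥤ Points B U where
  obj x := ⟨x.map ≫ f⟩
  map h := Points.homMk (congrArg (fun m => m ≫ f) h.down.down)

theorem hom₂_points_ext {C : Cat.{u, u + 1}} {A U : TopCat.{u}} {F G : C ⟶ Cat.of (Points A U)}
    (η θ : F ⟶ G) : η = θ := by
  apply Cat.Hom₂.ext
  ext x
  exact Points.hom_subsingleton (F.toFunctor.obj x) (G.toFunctor.obj x) _ _

/-- Two functors into a category of points are isomorphic if they agree on objects. -/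
def Points.natIso {C : Type (u + 1)} [Category.{u} C] {A U : TopCat.{u}} {F G : C ⥤ Points A U}
    (h : ∀ x, (F.obj x).map = (G.obj x).map) : F ≅ G :=
  NatIso.ofComponents (fun x => Points.isoMk (h x)) (fun _ => Subsingleton.elim _ _)

/-- The stack represented by a space `A` (Yoneda embedding): `U ↦ {continuous maps U ⟶ A}`. -/
def space (A : TopCat.{u}) : Prestack.{u} :=
  LocallyDiscrete.mkPseudofunctor
    (fun U => Cat.of (Points A U.unop))
    (fun g => (Points.pullback A g.unop).toCatHom)
    (fun U => Cat.Hom.isoMk (Points.natIso (G := 𝟭 (Points A U.unop))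
      (fun x => Category.id_comp x.map)))
    (fun f g => Cat.Hom.isoMk (Points.natIso
      (G := Points.pullback A f.unop ⋙ Points.pullback A g.unop)
      (fun x => Category.assoc g.unop f.unop x.map)))
    (fun _ _ _ => hom₂_points_ext _ _)
    (fun _ => hom₂_points_ext _ _)
    (fun _ => hom₂_points_ext _ _)

/-- The morphism of stacks given by a continuous map (Yoneda embedding on morphisms). -/
def spaceMap {A B : TopCat.{u}} (f : A ⟶ B) : space A ⟶ space B where
  app U := (Points.pushforward f U.as.unop).toCatHom
  naturality {U V} g := Cat.Hom.isoMk (Points.natIso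
    (F := Points.pullback A g.as.unop ⋙ Points.pushforward f V.as.unop)
    (G := Points.pushforward f U.as.unop ⋙ Points.pullback B g.as.unop)
    (fun x => Category.assoc g.as.unop x.map f))
  naturality_naturality _ := hom₂_points_ext _ _
  naturality_id _ := hom₂_points_ext _ _
  naturality_comp _ _ := hom₂_points_ext _ _

/-! ## `2`-cartesian squares, representable morphisms and atlases -/

section Cartesian

variable {P Y Z X : Prestack.{u}} {p : P ⟶ Y} {q : P ⟶ Z} {f : Y ⟶ X} {g : Z ⟶ X}

/-- The component of a `2`-isomorphism of morphisms of prestacks at `U` and at an object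
over `U`. -/
def isoApp {Y X : Prestack.{u}} {f g : Y ⟶ X} (θ : f ≅ g) (U : TopCat.{u}) (y : Y.obj (site U)) :
    (f.app (site U)).toFunctor.obj y ≅ (g.app (site U)).toFunctor.obj y where
  hom := (θ.hom.as.app (site U)).toNatTrans.app y
  inv := (θ.inv.as.app (site U)).toNatTrans.app y
  hom_inv_id := congrArg (fun η : f ⟶ f => (η.as.app (site U)).toNatTrans.app y) θ.hom_inv_id
  inv_hom_id := congrArg (fun η : g ⟶ g => (η.as.app (site U)).toNatTrans.app y) θ.inv_hom_id

/-- For a `2`-commutative square, the comparison functor from `P(U)` to the `2`-categorical fibre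
product of the categories `Y(U)` and `Z(U)` over `X(U)`. -/
def comparison (θ : p ≫ f ≅ q ≫ g) (U : TopCat.{u}) :
    P.obj (site U) ⥤
      CategoricalPullback (f.app (site U)).toFunctor (g.app (site U)).toFunctor where
  obj x :=
    { fst := (p.app (site U)).toFunctor.obj x
      snd := (q.app (site U)).toFunctor.obj x
      iso := isoApp θ U x }
  map {x y} h :=
    { fst := (p.app (site U)).toFunctor.map h
      snd := (q.app (site U)).toFunctor.map h
      w := (θ.hom.as.app (site U)).toNatTrans.naturality h }
  map_id x := by ext <;> exact CategoryTheory.Functor.map_id _ _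
  map_comp h k := by ext <;> exact CategoryTheory.Functor.map_comp _ _ _

/-- A `2`-commutative square of prestacks is `2`-cartesian if it identifies `P` with the
`2`-categorical fibre product `Y ×_X Z`, which is formed objectwise. -/
def IsTwoCartesian (θ : p ≫ f ≅ q ≫ g) : Prop :=
  ∀ U : TopCat.{u}, (comparison θ U).IsEquivalence

end Cartesian

/-- A morphism `f : Y ⟶ X` is representable if for each space `T` and each morphism `T ⟶ X` the
fibre product `T ×_X Y` is equivalent to a space. -/
def IsRepresentable {Y X : Prestack.{u}} (f : Y ⟶ X) : Prop :=
  ∀ (T : TopCat.{u}) (t : space T ⟶ X),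
    ∃ (Z : TopCat.{u}) (p : Z ⟶ T) (q : space Z ⟶ Y) (θ : spaceMap p ≫ t ≅ q ≫ f),
      IsTwoCartesian θ

/-- A map `f : V ⟶ W` of spaces has local sections if each point of its image has an open
neighbourhood on which `f` has a continuous section. -/
def HasLocalSections {V W : TopCat.{u}} (f : V ⟶ W) : Prop :=
  ∀ w ∈ Set.range f, ∃ N : Set W, IsOpen N ∧ w ∈ N ∧ ∃ σ : C(N, V), ∀ x : N, f (σ x) = x

/-- A map `a : A ⟶ X` from a space to a stack is an atlas if it is representable, surjective and
admits local sections. The last two conditions mean, as usual for representable morphisms, that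
the projections `T ×_X A ⟶ T` have these properties for all spaces `T` and all `T ⟶ X`. -/
structure IsAtlas {A : TopCat.{u}} {X : Prestack.{u}} (a : space A ⟶ X) : Prop where
  representable : IsRepresentable a
  surjective {T Z : TopCat.{u}} {t : space T ⟶ X} {p : Z ⟶ T} {q : space Z ⟶ space A}
    (θ : spaceMap p ≫ t ≅ q ≫ a) (hθ : IsTwoCartesian θ) : Function.Surjective p
  localSections {T Z : TopCat.{u}} {t : space T ⟶ X} {p : Z ⟶ T} {q : space Z ⟶ space A}
    (θ : spaceMap p ≫ t ≅ q ≫ a) (hθ : IsTwoCartesian θ) : HasLocalSections p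

/-! ## Topological groupoids -/

/-- A topological groupoid `Arr ⇒ Obj` with source `s`, range `r` and composition
`comp γ μ = μ ∘ γ`, defined for `r γ = s μ`. -/
structure TopGroupoid : Type (u + 1) where
  /-- The space of objects. -/
  Obj : TopCat.{u}
  /-- The space of arrows. -/
  Arr : TopCat.{u}
  /-- The source map. -/
  s : Arr ⟶ Obj
  /-- The range map. -/
  r : Arr ⟶ Obj
  /-- The identity map. -/
  one : Obj ⟶ Arr
  /-- The inversion map. -/
  inv : Arr ⟶ Arr
  /-- The composition: first `γ`, then `μ`. -/
  comp (γ μ : Arr) (h : r γ = s μ) : Arr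
  continuous_comp :
    Continuous (fun c : {c : Arr × Arr // r c.1 = s c.2} => comp c.1.1 c.1.2 c.2)
  s_one (x : Obj) : s (one x) = x
  r_one (x : Obj) : r (one x) = x
  s_inv (γ : Arr) : s (inv γ) = r γ
  r_inv (γ : Arr) : r (inv γ) = s γ
  s_comp (γ μ : Arr) (h : r γ = s μ) : s (comp γ μ h) = s γ
  r_comp (γ μ : Arr) (h : r γ = s μ) : r (comp γ μ h) = r μ
  one_comp (γ : Arr) : comp (one (s γ)) γ (r_one _) = γ
  comp_one (γ : Arr) : comp γ (one (r γ)) (s_one _).symm = γ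
  comp_inv (γ : Arr) : comp γ (inv γ) (s_inv γ).symm = one (s γ)
  inv_comp (γ : Arr) : comp (inv γ) γ (r_inv γ) = one (r γ)
  assoc (γ μ ν : Arr) (h : r γ = s μ) (k : r μ = s ν) :
    comp (comp γ μ h) ν ((r_comp γ μ h).trans k) =
      comp γ (comp μ ν k) (h.trans (s_comp μ ν k).symm)

namespace TopGroupoid

variable (G : TopGroupoid.{u})

/-- The identity `Obj ⟶ Arr` is a closed map. -/
def IsSeparated : Prop :=
  IsClosedMap G.one

/-- The map `(s, r) : Arr ⟶ Obj × Obj` is proper. -/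
def IsProper : Prop :=
  IsProperMap (fun γ : G.Arr => (G.s γ, G.r γ))

/-- Source and range are étale maps, i.e. local homeomorphisms. -/
def IsEtale : Prop :=
  IsLocalHomeomorph G.s ∧ IsLocalHomeomorph G.r

/-- A proper étale groupoid is very proper if there is a continuous cut-off function
`χ : Obj → [0, 1]` such that `r` is proper on the support of `s^* χ` and such that
`∑ χ (s γ) = 1` for each object `x`, where the sum is over all arrows `γ` with range `x`. -/
structure IsVeryProper : Prop where
  isProper : G.IsProper
  isEtale : G.IsEtale
  exists_cutoff : ∃ χ : C(G.Obj, ℝ), (∀ x, χ x ∈ Set.Icc (0 : ℝ) 1) ∧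
    IsProperMap (fun γ : tsupport (fun γ : G.Arr => χ (G.s γ)) => G.r (γ : G.Arr)) ∧
    ∀ x : G.Obj, HasSum (fun γ : {γ : G.Arr // G.r γ = x} => χ (G.s (γ : G.Arr))) 1

/-- Given a morphism `a : Obj ⟶ X` and a `2`-isomorphism `θ : a ∘ s ≅ a ∘ r`, each family of arrows
`γ : U ⟶ Arr` with source `y` and range `z` determines a morphism `a(y) ⟶ a(z)` in `X(U)`. -/
def arrow {G : TopGroupoid.{u}} {X : Prestack.{u}} {a : space G.Obj ⟶ X}
    (θ : spaceMap G.s ≫ a ≅ spaceMap G.r ≫ a) {U : TopCat.{u}} (γ : U ⟶ G.Arr)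
    {y z : Points G.Obj U} (hy : y.map = γ ≫ G.s) (hz : γ ≫ G.r = z.map) :
    (a.app (site U)).toFunctor.obj y ⟶ (a.app (site U)).toFunctor.obj z :=
  (a.app (site U)).toFunctor.map (Points.homMk (y := ⟨γ ≫ G.s⟩) hy) ≫
    (isoApp θ U (⟨γ⟩ : Points G.Arr U)).hom ≫
    (a.app (site U)).toFunctor.map (Points.homMk (x := ⟨γ ≫ G.r⟩) hz)

/-- `G` is, by means of `θ`, the topological groupoid `A ×_X A ⇒ A` of the map `a : A ⟶ X`, where
`A` is the space of objects of `G`: the arrows represent the fibre product `A ×_X A` with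
projections `s` and `r`, and the composition of arrows is the composition of the morphisms
`a(y) ⟶ a(z)` which they represent. (The identity and the inversion are determined by this.) -/
structure IsGroupoidOf {X : Prestack.{u}} (a : space G.Obj ⟶ X)
    (θ : spaceMap G.s ≫ a ≅ spaceMap G.r ≫ a) : Prop where
  isTwoCartesian : IsTwoCartesian θ
  arrow_comp {U : TopCat.{u}} (γ μ ν : U ⟶ G.Arr) (h : ∀ t, G.r (γ t) = G.s (μ t))
    (hν : ∀ t, ν t = G.comp (γ t) (μ t) (h t)) {x y z : Points G.Obj U}
    (hx : x.map = γ ≫ G.s) (hy : γ ≫ G.r = y.map) (hy' : y.map = μ ≫ G.s)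
    (hz : μ ≫ G.r = z.map) (hx' : x.map = ν ≫ G.s) (hz' : ν ≫ G.r = z.map) :
    arrow θ ν hx' hz' = arrow θ γ hx hy ≫ arrow θ μ hy' hz

end TopGroupoid

/-! ## Orbispaces -/

/-- An orbispace atlas of `X`: an atlas `a : A ⟶ X` such that the topological groupoid
`A ×_X A ⇒ A` is very proper, étale and separated. Here `A` is the object space of `G`. -/
structure IsOrbispaceAtlas {X : Prestack.{u}} (G : TopGroupoid.{u}) (a : space G.Obj ⟶ X) :
    Prop where
  isAtlas : IsAtlas a
  isGroupoidOf : ∃ θ : spaceMap G.s ≫ a ≅ spaceMap G.r ≫ a, G.IsGroupoidOf a θ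
  isVeryProper : G.IsVeryProper
  isEtale : G.IsEtale
  isSeparated : G.IsSeparated

/-- An orbispace is a stack in topological spaces which admits an orbispace atlas. -/
structure IsOrbispace (X : Prestack.{u}) : Prop where
  isTopStack : IsTopStack X
  exists_atlas : ∃ (G : TopGroupoid.{u}) (a : space G.Obj ⟶ X), IsOrbispaceAtlas G a

/-- A morphism of orbispaces is a representable morphism of stacks between orbispaces. -/
structure IsOrbispaceMorphism {Y X : Prestack.{u}} (f : Y ⟶ X) : Prop where
  source : IsOrbispace Y
  target : IsOrbispace X
  representable : IsRepresentable f

/-! ## Loop stacks -/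

/-- An object of the loop category of `C`: an object `pt` of `C` with an automorphism `aut`, i.e.
a functor to `C` from the category with one object and automorphism group `ℤ`. -/
structure Loop (C : Type (u + 1)) [Category.{u} C] : Type (u + 1) where
  /-- The underlying object. -/
  pt : C
  /-- The automorphism. -/
  aut : pt ≅ pt

/-- A morphism of loops: a morphism of the underlying objects which is compatible with the
automorphisms. -/
@[ext]
structure Loop.Hom {C : Type (u + 1)} [Category.{u} C] (x y : Loop C) : Type u where
  /-- The underlying morphism. -/
  hom : x.pt ⟶ y.pt
  comm : x.aut.hom ≫ hom = hom ≫ y.aut.hom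

instance (C : Type (u + 1)) [Category.{u} C] : Category.{u} (Loop C) where
  Hom := Loop.Hom
  id x := ⟨𝟙 _, by simp⟩
  comp f g := ⟨f.hom ≫ g.hom, by rw [← Category.assoc, f.comm, Category.assoc, g.comm,
    Category.assoc]⟩
  id_comp f := Loop.Hom.ext (Category.id_comp _)
  comp_id f := Loop.Hom.ext (Category.comp_id _)
  assoc f g h := Loop.Hom.ext (Category.assoc _ _ _)

namespace Loop

variable {C D : Type (u + 1)} [Category.{u} C] [Category.{u} D]

@[simp]
theorem id_hom (x : Loop C) : Hom.hom (𝟙 x) = 𝟙 x.pt := rfl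

@[simp]
theorem comp_hom {x y z : Loop C} (f : x ⟶ y) (g : y ⟶ z) :
    Hom.hom (f ≫ g) = f.hom ≫ g.hom := rfl

@[ext]
theorem hom_ext {x y : Loop C} {f g : x ⟶ y} (h : f.hom = g.hom) : f = g :=
  Hom.ext h

variable (C) in
/-- The functor which forgets the automorphism. -/
def forget : Loop C ⥤ C where
  obj x := x.pt
  map f := f.hom

/-- The functor induced on loops by a functor. -/
def mapFunctor (F : C ⥤ D) : Loop C ⥤ Loop D where
  obj x := ⟨F.obj x.pt, F.mapIso x.aut⟩
  map f := ⟨F.map f.hom, by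
    change F.map _ ≫ F.map _ = F.map _ ≫ F.map _
    rw [← F.map_comp, ← F.map_comp, f.comm]⟩
  map_id x := hom_ext (F.map_id _)
  map_comp f g := hom_ext (F.map_comp _ _)

/-- The natural transformation induced on loops by a natural transformation. -/
def mapNatTrans {F G : C ⥤ D} (η : F ⟶ G) : mapFunctor F ⟶ mapFunctor G where
  app x := ⟨η.app x.pt, η.naturality x.aut.hom⟩
  naturality _ _ f := hom_ext (η.naturality f.hom)

/-- An isomorphism of loops is an isomorphism of the underlying objects which is compatible with
the automorphisms. -/
def isoMk {x y : Loop C} (e : x.pt ≅ y.pt) (h : x.aut.hom ≫ e.hom = e.hom ≫ y.aut.hom) :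
    x ≅ y where
  hom := ⟨e.hom, h⟩
  inv := ⟨e.inv, by rw [Iso.comp_inv_eq, Category.assoc, h, Iso.inv_hom_id_assoc]⟩
  hom_inv_id := hom_ext e.hom_inv_id
  inv_hom_id := hom_ext e.inv_hom_id

theorem hom₂_ext {E : Cat.{u, u + 1}} {F G : E ⟶ Cat.of (Loop C)} {η θ : F ⟶ G}
    (h : ∀ x, Hom.hom (η.toNatTrans.app x) = Hom.hom (θ.toNatTrans.app x)) : η = θ := by
  apply Cat.Hom₂.ext
  apply NatTrans.ext
  funext x
  exact Loop.hom_ext (h x)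

end Loop

/-- The loop (inertia) prestack `LX`: its objects over `U` are the objects of `X` over `U` with an
automorphism. -/
def loopStack (X : Prestack.{u}) : Prestack.{u} where
  obj U := Cat.of (Loop (X.obj U))
  map g := (Loop.mapFunctor (X.map g).toFunctor).toCatHom
  map₂ η := (Loop.mapNatTrans (X.map₂ η).toNatTrans).toCatHom₂
  map₂_id f := Loop.hom₂_ext fun x =>
    congrArg (fun η => η.toNatTrans.app x.pt) (X.map₂_id f)
  map₂_comp f g := Loop.hom₂_ext fun x =>
    congrArg (fun η => η.toNatTrans.app x.pt) (X.map₂_comp f g)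
  mapId U := Cat.Hom.isoMk (NatIso.ofComponents (G := 𝟭 (Loop (X.obj U)))
    (fun x => Loop.isoMk ((Cat.Hom.toNatIso (X.mapId U)).app x.pt)
      ((X.mapId U).hom.toNatTrans.naturality x.aut.hom))
    (fun f => Loop.hom_ext ((X.mapId U).hom.toNatTrans.naturality f.hom)))
  mapComp f g := Cat.Hom.isoMk (NatIso.ofComponents
    (G := Loop.mapFunctor (X.map f).toFunctor ⋙ Loop.mapFunctor (X.map g).toFunctor)
    (fun x => Loop.isoMk ((Cat.Hom.toNatIso (X.mapComp f g)).app x.pt)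
      ((X.mapComp f g).hom.toNatTrans.naturality x.aut.hom))
    (fun h => Loop.hom_ext ((X.mapComp f g).hom.toNatTrans.naturality h.hom)))
  map₂_whisker_left f _ _ η := Loop.hom₂_ext fun x =>
    congrArg (fun η => η.toNatTrans.app x.pt) (X.map₂_whisker_left f η)
  map₂_whisker_right η h := Loop.hom₂_ext fun x =>
    congrArg (fun η => η.toNatTrans.app x.pt) (X.map₂_whisker_right η h)
  map₂_associator f g h := Loop.hom₂_ext fun x =>
    congrArg (fun η => η.toNatTrans.app x.pt) (X.map₂_associator f g h)
  map₂_left_unitor f := Loop.hom₂_ext fun x =>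
    congrArg (fun η => η.toNatTrans.app x.pt) (X.map₂_left_unitor f)
  map₂_right_unitor f := Loop.hom₂_ext fun x =>
    congrArg (fun η => η.toNatTrans.app x.pt) (X.map₂_right_unitor f)

/-- The canonical morphism `LX ⟶ X`, which forgets the automorphism. -/
def loopProjection (X : Prestack.{u}) : loopStack X ⟶ X where
  app U := (Loop.forget (X.obj U)).toCatHom
  naturality {U V} g := Cat.Hom.isoMk (Iso.refl
    (Loop.forget (X.obj U) ⋙ (X.map g).toFunctor))
  naturality_naturality η := by
    apply Cat.Hom₂.ext
    ext x
    exact (Category.comp_id _).trans (Category.id_comp _).symm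
  naturality_id U := by
    apply Cat.Hom₂.ext
    ext x
    change 𝟙 _ ≫ (X.mapId U).hom.toNatTrans.app x.pt =
      (X.mapId U).hom.toNatTrans.app x.pt ≫ 𝟙 _ ≫ 𝟙 _
    simp
  naturality_comp f g := by
    apply Cat.Hom₂.ext
    ext x
    change 𝟙 _ ≫ (X.mapComp f g).hom.toNatTrans.app x.pt =
      (X.mapComp f g).hom.toNatTrans.app x.pt ≫ 𝟙 _ ≫ 𝟙 _ ≫ 𝟙 _ ≫
        (X.map g).toFunctor.map (𝟙 _) ≫ 𝟙 _
    simp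

end Orbispace

/-! Let `a : space G.Obj ⟶ X` be an orbispace atlas with groupoid `G`. Since the arrows of `G`
represent isomorphisms between members of the family `a`, an automorphism of such a member is an
arrow whose source and range agree. The space `LoopSpace` of these arrows therefore carries a
tautological family of loops in `X`, and this is the atlas `loopAtlas` of the loop stack. Its
groupoid is `loopGroupoid`, the action groupoid of `G` acting on loops by conjugation
(`loopGroupoid_isGroupoidOf`).

The atlas property rests on `isTwoCartesian_loop`: a square over the loop stack is cartesian exactly
when the underlying square over `X` is. So the fibre product of `T` with `LoopSpace` over the loop
stack is the fibre product of `T` with `G.Obj` over `X`, and representability, surjectivity and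
local sections are inherited from `a`.

The groupoid properties also pass from `G` to `loopGroupoid`. Its source map is a base change of
that of `G`, its units are cut out by the units of `G`, and the cut-off function is pulled back
along the base point. For properness, an arrow is obtained as a limit in `G`, and separatedness is
what forces its range loop to be the prescribed one (`IsSeparated.limit_unique`), as `G.Arr` need
not be Hausdorff. The loop prestack is a stack because automorphisms of descent data glue.

For the projection, the fibre product of `t : space T ⟶ X` with the loop stack is the sheaf `endo t`
of automorphisms of members of `t`. Locally on `T` the family `t` is pulled back from the atlas, and
over such an open set `N` the sheaf is represented by the fibre product of `N` and `LoopSpace` over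
`G.Obj` (`exists_isChart`). A sheaf that is representable locally on `T` is representable
(`exists_universal`). -/

namespace Orbispace

/-! ## Families over a space and their restrictions -/

section Calculus

variable {X : Prestack.{u}} {S T R U V W : TopCat.{u}}

/-- The object of `X` over `U` which `f : space T ⟶ X` assigns to a map `m : U ⟶ T`. -/
def sec (f : space T ⟶ X) (m : U ⟶ T) : X.obj (site U) :=
  (f.app (site U)).toFunctor.obj ⟨m⟩

/-- Equal maps determine isomorphic families. -/
def secEq (f : space T ⟶ X) {m n : U ⟶ T} (h : m = n) : sec f m ≅ sec f n :=
  (f.app (site U)).toFunctor.mapIso (Points.isoMk (x := ⟨m⟩) (y := ⟨n⟩) h)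

@[simp]
theorem secEq_rfl (f : space T ⟶ X) {m : U ⟶ T} (h : m = m) : secEq f h = Iso.refl _ :=
  (f.app (site U)).toFunctor.mapIso_refl _

theorem secEq_trans (f : space T ⟶ X) {m n k : U ⟶ T} (h : m = n) (h' : n = k) :
    (secEq f h).hom ≫ (secEq f h').hom = (secEq f (h.trans h')).hom := by
  subst h
  simp

theorem secEq_trans_assoc (f : space T ⟶ X) {m n k : U ⟶ T} (h : m = n) (h' : n = k)
    {Y : X.obj (site U)} (α : sec f k ⟶ Y) :
    (secEq f h).hom ≫ (secEq f h').hom ≫ α = (secEq f (h.trans h')).hom ≫ α := by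
  rw [← Category.assoc, secEq_trans]

/-- The comparison of a family over `V` with a restricted family. -/
def secNat (f : space T ⟶ X) (g : V ⟶ U) {m : U ⟶ T} {m' : V ⟶ T} (h : m' = g ≫ m) :
    sec f m' ≅ (X.map g.op.toLoc).toFunctor.obj (sec f m) :=
  secEq f h ≪≫ (Cat.Hom.toNatIso (f.naturality g.op.toLoc)).app ⟨m⟩

/-- The restriction of morphisms between families. -/
def res {f : space T ⟶ X} {f' : space S ⟶ X} (g : V ⟶ U) {m : U ⟶ T} {n : U ⟶ S}
    {m' : V ⟶ T} {n' : V ⟶ S} (hm : m' = g ≫ m) (hn : n' = g ≫ n)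
    (α : sec f m ⟶ sec f' n) : sec f m' ⟶ sec f' n' :=
  (secNat f g hm).hom ≫ (X.map g.op.toLoc).toFunctor.map α ≫ (secNat f' g hn).inv

variable {f : space T ⟶ X} {f' : space S ⟶ X} {f'' : space R ⟶ X}

/-- Trades the inverse inside `res` for a commuting square, the shape in which the axioms for strong
transformations and modifications are available. -/
theorem res_iff (g : V ⟶ U) {m : U ⟶ T} {n : U ⟶ S} {m' : V ⟶ T} {n' : V ⟶ S}
    (hm : m' = g ≫ m) (hn : n' = g ≫ n) (α : sec f m ⟶ sec f' n) (β : sec f m' ⟶ sec f' n') :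
    res g hm hn α = β ↔ β ≫ (secNat f' g hn).hom =
      (secNat f g hm).hom ≫ (X.map g.op.toLoc).toFunctor.map α := by
  rw [res, ← Category.assoc, Iso.comp_inv_eq]
  exact eq_comm

theorem res_secNat (g : V ⟶ U) {m : U ⟶ T} {n : U ⟶ S} {m' : V ⟶ T} {n' : V ⟶ S}
    (hm : m' = g ≫ m) (hn : n' = g ≫ n) (α : sec f m ⟶ sec f' n) :
    res g hm hn α ≫ (secNat f' g hn).hom =
      (secNat f g hm).hom ≫ (X.map g.op.toLoc).toFunctor.map α :=
  (res_iff g hm hn α _).1 rfl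

theorem res_comp (g : V ⟶ U) {m : U ⟶ T} {n : U ⟶ S} {k : U ⟶ R} {m' : V ⟶ T} {n' : V ⟶ S}
    {k' : V ⟶ R} (hm : m' = g ≫ m) (hn : n' = g ≫ n) (hk : k' = g ≫ k)
    (α : sec f m ⟶ sec f' n) (β : sec f' n ⟶ sec f'' k) :
    res g hm hk (α ≫ β) = res g hm hn α ≫ res g hn hk β := by
  simp [res]

@[simp]
theorem res_id (g : V ⟶ U) {m : U ⟶ T} {m' : V ⟶ T} (hm : m' = g ≫ m) :
    res g hm hm (𝟙 (sec f m)) = 𝟙 _ := by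
  simp [res]

/-- The restriction of isomorphisms between families. -/
@[simps]
def resIso (g : V ⟶ U) {m : U ⟶ T} {n : U ⟶ S} {m' : V ⟶ T} {n' : V ⟶ S}
    (hm : m' = g ≫ m) (hn : n' = g ≫ n) (e : sec f m ≅ sec f' n) :
    sec f m' ≅ sec f' n' where
  hom := res g hm hn e.hom
  inv := res g hn hm e.inv
  hom_inv_id := by rw [← res_comp, e.hom_inv_id, res_id]
  inv_hom_id := by rw [← res_comp, e.inv_hom_id, res_id]

theorem res_secEq (g : V ⟶ U) {m n : U ⟶ T} {m' n' : V ⟶ T} (hm : m' = g ≫ m)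
    (hn : n' = g ≫ n) (h : m = n) :
    res g hm hn (secEq f h).hom = (secEq f (by rw [hm, hn, h])).hom := by
  subst h hm hn
  simp

theorem secNat_hom (f : space T ⟶ X) (g : V ⟶ U) (m : U ⟶ T) :
    (secNat f g (rfl : g ≫ m = g ≫ m)).hom =
      (f.naturality g.op.toLoc).hom.toNatTrans.app ⟨m⟩ :=
  (congrArg (fun k : _ ⟶ _ => k ≫ (f.naturality g.op.toLoc).hom.toNatTrans.app ⟨m⟩)
    ((f.app (site V)).toFunctor.map_id ⟨g ≫ m⟩)).trans (Category.id_comp _)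

/-- This is the axiom `naturality_comp` of the transformation `f`, freed of its identity cells. -/
theorem secNat_comp (g : V ⟶ U) (h : W ⟶ V) {m : U ⟶ T} {m' : V ⟶ T} {m'' : W ⟶ T}
    (hm : m' = g ≫ m) (hm' : m'' = h ≫ m') (hm'' : m'' = (h ≫ g) ≫ m) :
    (secNat f (h ≫ g) hm'').hom ≫
        (X.mapComp g.op.toLoc h.op.toLoc).hom.toNatTrans.app (sec f m) =
      (secNat f h hm').hom ≫ (X.map h.op.toLoc).toFunctor.map (secNat f g hm).hom := by
  subst hm hm'
  have := congrArg (fun η => η.toNatTrans.app ⟨m⟩) (f.naturality_comp g.op.toLoc h.op.toLoc)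
  rw [secNat_hom, secNat_hom, secNat_hom]
  refine this.trans ?_
  have key (A B C D : X.obj (site W)) (k : A ⟶ A) (hk : k = 𝟙 A) (p : A ⟶ B) (q : B ⟶ C) :
      k ≫ 𝟙 _ ≫ p ≫ 𝟙 _ ≫ q ≫ 𝟙 _ = p ≫ q := by
    simp [hk]
  exact key _ _ _ (sec f (h ≫ g ≫ m)) _ ((f.app (site W)).toFunctor.map_id _) _ _

theorem secNat_id {m m' : U ⟶ T} (h : m' = 𝟙 U ≫ m) :
    (secNat f (𝟙 U) h).hom ≫ (X.mapId (site U)).hom.toNatTrans.app (sec f m) =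
      (secEq f h).hom := by
  have := congrArg (fun η => η.toNatTrans.app ⟨m⟩) (f.naturality_id (site U))
  subst h
  rw [secNat_hom]
  refine this.trans ?_
  have key (A : X.obj (site U)) (k l : A ⟶ A) (hk : k = l) :
      k ≫ 𝟙 _ ≫ 𝟙 _ = l := by
    simp [hk]
  exact key _ _ _ rfl

/-- Restriction is functorial because the comparison cells obey `secNat_comp` at both ends and
`mapComp` is natural in `α`. -/
theorem res_res (g : V ⟶ U) (h : W ⟶ V) {m : U ⟶ T} {n : U ⟶ S} {m' : V ⟶ T} {n' : V ⟶ S}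
    {m'' : W ⟶ T} {n'' : W ⟶ S} (hm : m' = g ≫ m) (hn : n' = g ≫ n) (hm' : m'' = h ≫ m')
    (hn' : n'' = h ≫ n') (α : sec f m ⟶ sec f' n) :
    res h hm' hn' (res g hm hn α) =
      res (h ≫ g) (by rw [hm', hm, Category.assoc]) (by rw [hn', hn, Category.assoc]) α := by
  symm
  rw [res_iff]
  have h1 := secNat_comp (f := f) g h hm hm' (by rw [hm', hm, Category.assoc])
  have h2 := secNat_comp (f := f') g h hn hn' (by rw [hn', hn, Category.assoc])
  have h3 := (X.mapComp g.op.toLoc h.op.toLoc).hom.toNatTrans.naturality α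
  have h4 := res_secNat g hm hn α
  have h5 := res_secNat h hm' hn' (res g hm hn α)
  have key {C D : Type (u + 1)} [Category.{u} C] [Category.{u} D] (H : D ⥤ C) (A B : C)
      (A' B' : D) {P P' : C} {Q Q' : D}
      (s : A ⟶ P) (s' : B ⟶ P') (c : P ≅ H.obj Q) (c' : P' ≅ H.obj Q') (t : A ⟶ H.obj A')
      (t' : B ⟶ H.obj B') (w : A' ⟶ Q) (w' : B' ⟶ Q') (k : P ⟶ P') (k' : Q ⟶ Q') (r : A' ⟶ B')
      (rr : A ⟶ B) (h1 : s ≫ c.hom = t ≫ H.map w) (h2 : s' ≫ c'.hom = t' ≫ H.map w')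
      (h3 : k ≫ c'.hom = c.hom ≫ H.map k') (h4 : r ≫ w' = w ≫ k') (h5 : rr ≫ t' = t ≫ H.map r) :
      rr ≫ s' = s ≫ k := by
    rw [← cancel_mono c'.hom, Category.assoc, Category.assoc, h2, h3, reassoc_of% h5,
      reassoc_of% h1, ← H.map_comp, ← H.map_comp, h4]
  exact key (X.map h.op.toLoc).toFunctor _ _ _ _ _ _
    ((Cat.Hom.toNatIso (X.mapComp g.op.toLoc h.op.toLoc)).app (sec f m))
    ((Cat.Hom.toNatIso (X.mapComp g.op.toLoc h.op.toLoc)).app (sec f' n)) _ _ _ _ _ _ _ _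
    h1 h2 h3 h4 h5

theorem res_one {m m' : U ⟶ T} {n n' : U ⟶ S} (hm : m' = 𝟙 U ≫ m) (hn : n' = 𝟙 U ≫ n)
    (α : sec f m ⟶ sec f' n) :
    res (𝟙 U) hm hn α = (secEq f hm).hom ≫ α ≫ (secEq f' hn).inv := by
  rw [res_iff]
  have h1 := secNat_id (f := f) hm
  have h2 := secNat_id (f := f') hn
  have h3 := (X.mapId (site U)).hom.toNatTrans.naturality α
  have key {C : Type (u + 1)} [Category.{u} C] {A B A' B' P Q : C} (s : A ⟶ P) (s' : B ⟶ Q)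
      (c : P ⟶ A') (c' : Q ≅ B') (k : P ⟶ Q) (a : A' ⟶ B') (e : A ⟶ A') (e' : B ≅ B')
      (h1 : s ≫ c = e) (h2 : s' ≫ c'.hom = e'.hom) (h3 : k ≫ c'.hom = c ≫ a) :
      (e ≫ a ≫ e'.inv) ≫ s' = s ≫ k := by
    rw [← cancel_mono c'.hom]
    simp [h2, h3, ← h1]
  exact key _ _ _ ((Cat.Hom.toNatIso (X.mapId (site U))).app (sec f' n)) _ _ _ _ h1 h2 h3

/-- The component of a `2`-isomorphism between morphisms on a space. -/
def secIso {f' : space T ⟶ X} (θ : f ≅ f') (m : U ⟶ T) : sec f m ≅ sec f' m := isoApp θ U ⟨m⟩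

theorem res_secIso {f' : space T ⟶ X} (θ : f ≅ f') (g : V ⟶ U) (m : U ⟶ T) :
    res g rfl rfl (secIso θ m).hom = (secIso θ (g ≫ m)).hom := by
  rw [res_iff]
  have := congrArg (fun η => η.toNatTrans.app ⟨m⟩) (θ.hom.as.naturality g.op.toLoc)
  rw [secNat_hom, secNat_hom]
  exact this

/-- A `2`-isomorphism between morphisms defined on a space, given by its components. -/
def spaceIsoMk {f' : space T ⟶ X} (e : ∀ (U : TopCat.{u}) (m : U ⟶ T), sec f m ≅ sec f' m)
    (he : ∀ {U V : TopCat.{u}} (g : V ⟶ U) (m : U ⟶ T),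
      res g rfl rfl (e U m).hom = (e V (g ≫ m)).hom) :
    f ≅ f' :=
  Pseudofunctor.StrongTrans.isoMk
    (fun U => Cat.Hom.isoMk (NatIso.ofComponents
      (F := (f.app U).toFunctor) (G := (f'.app U).toFunctor)
      (fun x => e U.as.unop x.map) (by
        rintro ⟨m⟩ ⟨n⟩ ⟨⟨h : m = n⟩⟩
        subst h
        erw [(f.app U).toFunctor.map_id, (f'.app U).toFunctor.map_id]
        rw [Category.id_comp, Category.comp_id])))
    (fun {U V} g => by
      apply Cat.Hom₂.ext
      ext x
      have := (res_iff g.as.unop _ _ _ _).1 (he g.as.unop x.map)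
      rw [secNat_hom, secNat_hom] at this
      exact this)

end Calculus

end Orbispace

namespace Orbispace

/-! ## Squares of spaces over a stack -/

section Squares

variable {X : Prestack.{u}} {Z T A U V W : TopCat.{u}}

/-- The action of a morphism of represented stacks on points. -/
def pt (q : space Z ⟶ space A) (z : U ⟶ Z) : U ⟶ A :=
  ((q.app (site U)).toFunctor.obj ⟨z⟩).map

@[simp]
theorem pt_spaceMap (f : Z ⟶ A) (z : U ⟶ Z) : pt (spaceMap f) z = z ≫ f := rfl

/-- The naturality cell of `q` lives in a discrete category of points, so it is an equality of maps.
-/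
theorem pt_comp (q : space Z ⟶ space A) (g : V ⟶ U) (z : U ⟶ Z) :
    pt q (g ≫ z) = g ≫ pt q z :=
  ((q.naturality g.op.toLoc).hom.toNatTrans.app ⟨z⟩).down.down

/-- The Yoneda lemma: `q` is determined on points by its value on the identity. -/
theorem pt_eq_comp (q : space Z ⟶ space A) (z : U ⟶ Z) : pt q z = z ≫ pt q (𝟙 Z) := by
  rw [← pt_comp, Category.comp_id]

theorem secNat_spaceMap_comp (p : Z ⟶ T) (t : space T ⟶ X) (g : V ⟶ U) (z : U ⟶ Z) :
    (secNat (spaceMap p ≫ t) g (rfl : g ≫ z = g ≫ z)).hom =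
      (secNat t g (Category.assoc g z p : _ = g ≫ z ≫ p)).hom := by
  rw [secNat_hom]
  have key {C : Type (u + 1)} [Category.{u} C] {A B : C} (k k' : A ⟶ A) (l : A ⟶ B)
      (hk : k = 𝟙 A) (hk' : k' = 𝟙 A) : 𝟙 _ ≫ k ≫ 𝟙 _ ≫ l ≫ 𝟙 _ = k' ≫ l := by
    simp [hk, hk']
  exact key _ _ _ ((t.app (site V)).toFunctor.map_id _) ((t.app (site V)).toFunctor.map_id _)

theorem secNat_comp_right (q : space Z ⟶ space A) (a : space A ⟶ X) (g : V ⟶ U) (z : U ⟶ Z) :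
    (secNat (q ≫ a) g (rfl : g ≫ z = g ≫ z)).hom = (secNat a g (pt_comp q g z)).hom := by
  rw [secNat_hom]
  have key {C : Type (u + 1)} [Category.{u} C] {A B D : C} (k : A ⟶ B) (l : B ⟶ D) :
      𝟙 _ ≫ k ≫ 𝟙 _ ≫ l ≫ 𝟙 _ = k ≫ l := by
    simp
  exact key _ _

variable {t : space T ⟶ X} {a : space A ⟶ X} {p : Z ⟶ T} {q : space Z ⟶ space A}

/-- The components of the `2`-isomorphism of a square of spaces. -/
def sqIso (θ : spaceMap p ≫ t ≅ q ≫ a) (z : U ⟶ Z) : sec t (z ≫ p) ≅ sec a (pt q z) :=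
  secIso θ z

theorem res_sqIso (θ : spaceMap p ≫ t ≅ q ≫ a) (g : V ⟶ U) (z : U ⟶ Z) :
    res g (Category.assoc g z p) (pt_comp q g z) (sqIso θ z).hom = (sqIso θ (g ≫ z)).hom := by
  have := (res_iff _ _ _ _ _).1 (res_secIso θ g z)
  rw [secNat_spaceMap_comp, secNat_comp_right] at this
  exact (res_iff _ _ _ _ _).2 this

/-- A square of spaces over a stack, given by its components. -/
def sqMk (e : ∀ (U : TopCat.{u}) (z : U ⟶ Z), sec t (z ≫ p) ≅ sec a (pt q z))
    (he : ∀ {U V : TopCat.{u}} (g : V ⟶ U) (z : U ⟶ Z),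
      res g (Category.assoc g z p) (pt_comp q g z) (e U z).hom = (e V (g ≫ z)).hom) :
    spaceMap p ≫ t ≅ q ≫ a :=
  spaceIsoMk (f := spaceMap p ≫ t) (f' := q ≫ a) e (fun g z => by
    have := (res_iff _ _ _ _ _).1 (he g z)
    rw [res_iff, secNat_spaceMap_comp, secNat_comp_right]
    exact this)

/-- A square of spaces over a stack is `2`-cartesian if and only if each pair of points with an
isomorphism of the corresponding families comes from a unique point. -/
theorem isTwoCartesian_iff (θ : spaceMap p ≫ t ≅ q ≫ a) :
    IsTwoCartesian θ ↔ ∀ (U : TopCat.{u}) (m : U ⟶ T) (n : U ⟶ A) (ψ : sec t m ≅ sec a n),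
      ∃! z : U ⟶ Z, ∃ (h₁ : z ≫ p = m) (h₂ : pt q z = n),
        (secEq t h₁).hom ≫ ψ.hom = (sqIso θ z).hom ≫ (secEq a h₂).hom := by
  constructor
  · intro h U m n ψ
    have := h U
    let Q : CategoricalPullback (t.app (site U)).toFunctor (a.app (site U)).toFunctor :=
      ⟨⟨m⟩, ⟨n⟩, ψ⟩
    have ez := (comparison θ U).objObjPreimageIso Q
    refine ⟨((comparison θ U).objPreimage Q).map, ⟨ez.hom.fst.down.down, ez.hom.snd.down.down, ez.hom.w⟩, ?_⟩
    rintro y ⟨h₁, h₂, h₃⟩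
    let k : (comparison θ U).obj ⟨y⟩ ⟶ Q := ⟨⟨⟨h₁⟩⟩, ⟨⟨h₂⟩⟩, h₃⟩
    exact ((comparison θ U).preimage (k ≫ ez.inv)).down.down
  · intro h U
    -- Points form discrete categories, so faithfulness is automatic; fullness is the uniqueness of
    -- `z`, and essential surjectivity is its existence.
    refine { faithful := ⟨fun _ => Points.hom_subsingleton _ _ _ _⟩, full := ⟨?_⟩, essSurj := ⟨?_⟩ }
    · rintro ⟨y⟩ ⟨z⟩ k
      obtain ⟨x, -, hx⟩ := h U (z ≫ p) (pt q z) (sqIso θ z)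
      have hy := hx y ⟨k.fst.down.down, k.snd.down.down, k.w⟩
      have hz := hx z ⟨rfl, rfl, by simp⟩
      exact ⟨Points.homMk (hy.trans hz.symm), by ext <;> exact Points.hom_subsingleton _ _ _ _⟩
    · rintro ⟨⟨m⟩, ⟨n⟩, ψ⟩
      obtain ⟨z, ⟨h₁, h₂, h₃⟩, -⟩ := h U m n ψ
      exact ⟨⟨z⟩, ⟨CategoricalPullback.mkIso (Points.isoMk h₁) (Points.isoMk h₂) h₃⟩⟩

end Squares

/-! ## Loops in families -/

section Loops

variable {X : Prestack.{u}} {Z T A U V W : TopCat.{u}}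

/-- The family underlying a family of loops. -/
abbrev base (t : space T ⟶ loopStack X) : space T ⟶ X := t ≫ loopProjection X

/-- The automorphisms of a family of loops. -/
def loopAut (t : space T ⟶ loopStack X) (m : U ⟶ T) : sec (base t) m ≅ sec (base t) m :=
  Loop.aut (C := X.obj (site U)) (sec t m)

theorem secNat_base (t : space T ⟶ loopStack X) (g : V ⟶ U) (m : U ⟶ T) :
    (secNat (base t) g (rfl : g ≫ m = g ≫ m)).hom =
      Loop.Hom.hom (C := X.obj (site V)) (secNat t g (rfl : g ≫ m = g ≫ m)).hom := by
  rw [secNat_hom, secNat_hom]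
  have key {C : Type (u + 1)} [Category.{u} C] {A B : C} (k : A ⟶ B) :
      𝟙 _ ≫ k ≫ 𝟙 _ ≫ 𝟙 _ ≫ 𝟙 _ = k := by
    simp
  exact key _

theorem res_loopAut (t : space T ⟶ loopStack X) (g : V ⟶ U) (m : U ⟶ T) :
    res g rfl rfl (loopAut t m).hom = (loopAut t (g ≫ m)).hom := by
  rw [res_iff, secNat_base]
  exact Loop.Hom.comm (C := X.obj (site V)) (secNat t g (rfl : g ≫ m = g ≫ m)).hom

/-- The morphism to the loop stack given by a morphism with an automorphism. -/
def liftAut {Y : Prestack.{u}} (f : Y ⟶ X) (θ : f ≅ f) : Y ⟶ loopStack X where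
  app U := Functor.toCatHom
    { obj := fun y => (⟨(f.app U).toFunctor.obj y, isoApp θ U.as.unop y⟩ : Loop (X.obj U))
      map := fun h => ⟨(f.app U).toFunctor.map h, ((θ.hom.as.app U).toNatTrans.naturality h).symm⟩
      map_id := fun x => Loop.hom_ext ((f.app U).toFunctor.map_id x)
      map_comp := fun g h => Loop.hom_ext ((f.app U).toFunctor.map_comp g h) }
  naturality g := Cat.Hom.isoMk (NatIso.ofComponents
    (fun y => Loop.isoMk ((Cat.Hom.toNatIso (f.naturality g)).app y)
      (congrArg (fun η => η.toNatTrans.app y) (θ.hom.as.naturality g)))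
    (fun h => Loop.hom_ext ((f.naturality g).hom.toNatTrans.naturality h)))
  naturality_naturality η := Loop.hom₂_ext fun x =>
    congrArg (fun η => η.toNatTrans.app x) (f.naturality_naturality η)
  naturality_id U := Loop.hom₂_ext fun x =>
    congrArg (fun η => η.toNatTrans.app x) (f.naturality_id U)
  naturality_comp g h := Loop.hom₂_ext fun x =>
    congrArg (fun η => η.toNatTrans.app x) (f.naturality_comp g h)

/-- The `2`-isomorphism of a square, given by automorphisms of the families over `Z`. -/
abbrev famAut (p : Z ⟶ T) (t : space T ⟶ X)
    (e : ∀ (U : TopCat.{u}) (z : U ⟶ Z), sec t (z ≫ p) ≅ sec t (z ≫ p))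
    (he : ∀ {U V : TopCat.{u}} (g : V ⟶ U) (z : U ⟶ Z),
      res g (Category.assoc g z p) (Category.assoc g z p) (e U z).hom = (e V (g ≫ z)).hom) :
    spaceMap p ≫ t ≅ spaceMap p ≫ t :=
  sqMk (q := spaceMap p) e he

/-- The family of loops given by a family of objects with compatible automorphisms. -/
def loopLift (p : Z ⟶ T) (t : space T ⟶ X)
    (e : ∀ (U : TopCat.{u}) (z : U ⟶ Z), sec t (z ≫ p) ≅ sec t (z ≫ p))
    (he : ∀ {U V : TopCat.{u}} (g : V ⟶ U) (z : U ⟶ Z),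
      res g (Category.assoc g z p) (Category.assoc g z p) (e U z).hom = (e V (g ≫ z)).hom) :
    space Z ⟶ loopStack X :=
  liftAut (spaceMap p ≫ t) (famAut p t e he)

section

variable {p : Z ⟶ T} {t : space T ⟶ X}
  {e : ∀ (U : TopCat.{u}) (z : U ⟶ Z), sec t (z ≫ p) ≅ sec t (z ≫ p)}
  {he : ∀ {U V : TopCat.{u}} (g : V ⟶ U) (z : U ⟶ Z),
    res g (Category.assoc g z p) (Category.assoc g z p) (e U z).hom = (e V (g ≫ z)).hom}

theorem secNat_loopLift (g : V ⟶ U) (z : U ⟶ Z) :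
    Loop.Hom.hom (C := X.obj (site V))
      (secNat (loopLift p t e he) g (rfl : g ≫ z = g ≫ z)).hom =
      (secNat t g (Category.assoc g z p : _ = g ≫ z ≫ p)).hom := by
  rw [← secNat_spaceMap_comp, secNat_hom, secNat_hom]
  rfl

end

section

variable {B : TopCat.{u}} {s₀ : B ⟶ A} {a : space A ⟶ X}
  {e : ∀ (U : TopCat.{u}) (z : U ⟶ B), sec a (z ≫ s₀) ≅ sec a (z ≫ s₀)}
  {he : ∀ {U V : TopCat.{u}} (g : V ⟶ U) (z : U ⟶ B),
    res g (Category.assoc g z s₀) (Category.assoc g z s₀) (e U z).hom = (e V (g ≫ z)).hom}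
  {t : space T ⟶ loopStack X} {p : Z ⟶ T} {q : space Z ⟶ space B}

/-- The components of a square over the loop stack. -/
def loopSq (θ : spaceMap p ≫ t ≅ q ≫ loopLift s₀ a e he) (z : U ⟶ Z) :
    sec (base t) (z ≫ p) ≅ sec a (pt q z ≫ s₀) :=
  (Loop.forget (X.obj (site U))).mapIso (sqIso θ z)

theorem loopSq_comm (θ : spaceMap p ≫ t ≅ q ≫ loopLift s₀ a e he) (z : U ⟶ Z) :
    (loopAut t (z ≫ p)).hom ≫ (loopSq θ z).hom = (loopSq θ z).hom ≫ (e U (pt q z)).hom :=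
  Loop.Hom.comm (C := X.obj (site U)) (sqIso θ z).hom

/-- Forgetting automorphisms is faithful and, by `secNat_base` and `secNat_loopLift`, carries
comparison cells to comparison cells. Restrictions over the loop stack can thus be tested on
underlying morphisms. -/
theorem res_loopSq_iff {g : V ⟶ U} {m : U ⟶ T} {n : U ⟶ B} {n' : V ⟶ B} (hn : n' = g ≫ n)
    {m' : V ⟶ T} (hm : m' = g ≫ m)
    (α : sec t m ⟶ sec (loopLift s₀ a e he) n) (β : sec t m' ⟶ sec (loopLift s₀ a e he) n') :
    res g hm hn α = β ↔ res (f := base t) (f' := a) g hm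
      ((congrArg (· ≫ s₀) hn).trans (Category.assoc g n s₀))
      (Loop.Hom.hom (C := X.obj (site U)) α) = Loop.Hom.hom (C := X.obj (site V)) β := by
  subst hn hm
  refine (res_iff _ _ _ _ _).trans (Iff.trans ?_ (res_iff _ _ _ _ _).symm)
  rw [secNat_base, ← secNat_loopLift (he := he)]
  exact ⟨fun h => congrArg (Loop.Hom.hom (C := X.obj (site V))) h,
    fun h => Loop.hom_ext (C := X.obj (site V)) h⟩

theorem res_loopSq (θ : spaceMap p ≫ t ≅ q ≫ loopLift s₀ a e he) (g : V ⟶ U) (z : U ⟶ Z) :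
    res g (Category.assoc g z p)
      ((congrArg (· ≫ s₀) (pt_comp q g z)).trans (Category.assoc g (pt q z) s₀)) (loopSq θ z).hom =
      (loopSq θ (g ≫ z)).hom :=
  (res_loopSq_iff _ _ _ _).1 (res_sqIso θ g z)

/-- A square over the loop stack, given by its components. -/
def loopSqMk (k : ∀ (U : TopCat.{u}) (z : U ⟶ Z), sec (base t) (z ≫ p) ≅ sec a (pt q z ≫ s₀))
    (hk : ∀ (U : TopCat.{u}) (z : U ⟶ Z),
      (loopAut t (z ≫ p)).hom ≫ (k U z).hom = (k U z).hom ≫ (e U (pt q z)).hom)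
    (hk' : ∀ {U V : TopCat.{u}} (g : V ⟶ U) (z : U ⟶ Z), res g (Category.assoc g z p)
      ((congrArg (· ≫ s₀) (pt_comp q g z)).trans (Category.assoc g (pt q z) s₀)) (k U z).hom =
        (k V (g ≫ z)).hom) :
    spaceMap p ≫ t ≅ q ≫ loopLift s₀ a e he :=
  sqMk (fun U z => Loop.isoMk (C := X.obj (site U)) (k U z) (hk U z))
    (fun g z => (res_loopSq_iff _ _ _ _).2 (hk' g z))

/-- The criterion for `2`-cartesian squares over the loop stack. -/
theorem isTwoCartesian_loop_iff (θ : spaceMap p ≫ t ≅ q ≫ loopLift s₀ a e he) :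
    IsTwoCartesian θ ↔ ∀ (U : TopCat.{u}) (m : U ⟶ T) (n : U ⟶ B)
      (ψ : sec (base t) m ≅ sec a (n ≫ s₀)),
      (loopAut t m).hom ≫ ψ.hom = ψ.hom ≫ (e U n).hom →
      ∃! z : U ⟶ Z, ∃ (h₁ : z ≫ p = m) (h₂ : pt q z = n),
        (secEq (base t) h₁).hom ≫ ψ.hom =
          (loopSq θ z).hom ≫ (secEq a (congrArg (· ≫ s₀) h₂)).hom := by
  rw [isTwoCartesian_iff]
  constructor
  · intro h U m n ψ hψ
    refine (existsUnique_congr fun z => exists_congr fun h₁ => exists_congr fun h₂ => ?_).1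
      (h U m n (Loop.isoMk (C := X.obj (site U)) ψ hψ))
    exact ⟨fun h => congrArg (Loop.Hom.hom (C := X.obj (site U))) h,
      fun h => Loop.hom_ext (C := X.obj (site U)) h⟩
  · intro h U m n ψ
    refine (existsUnique_congr fun z => exists_congr fun h₁ => exists_congr fun h₂ => ?_).1
      (h U m n ((Loop.forget (X.obj (site U))).mapIso ψ)
        (Loop.Hom.comm (C := X.obj (site U)) ψ.hom))
    exact ⟨fun h => Loop.hom_ext (C := X.obj (site U)) h,
      fun h => congrArg (Loop.Hom.hom (C := X.obj (site U))) h⟩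

end

end Loops

end Orbispace

/-! ### Topological groupoids and their loop groupoids. -/

namespace Orbispace

namespace TopGroupoid

variable (G : TopGroupoid.{u})

/-! ### Computations in topological groupoids -/

theorem comp_congr {γ γ' μ μ' : G.Arr} (hγ : γ = γ') (hμ : μ = μ') (h : G.r γ = G.s μ) :
    G.comp γ μ h = G.comp γ' μ' (by rw [← hγ, ← hμ, h]) := by
  subst hγ hμ
  rfl

variable {G}

theorem one_comp_of_eq {x : G.Obj} {γ : G.Arr} (h : G.r (G.one x) = G.s γ) :
    G.comp (G.one x) γ h = γ := by
  rw [G.r_one] at h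
  subst h
  exact G.one_comp γ

theorem comp_one_of_eq {x : G.Obj} {γ : G.Arr} (h : G.r γ = G.s (G.one x)) :
    G.comp γ (G.one x) h = γ := by
  rw [G.s_one] at h
  subst h
  exact G.comp_one γ

theorem comp_left_cancel {γ μ ν : G.Arr} (h : G.r γ = G.s μ) (k : G.r γ = G.s ν)
    (e : G.comp γ μ h = G.comp γ ν k) : μ = ν := by
  have aux (ξ : G.Arr) (l : G.r γ = G.s ξ) :
      G.comp (G.inv γ) (G.comp γ ξ l) (by rw [G.r_inv, G.s_comp]) = ξ := by
    rw [← G.assoc _ _ _ (G.r_inv γ) l, G.comp_congr (G.inv_comp γ) rfl,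
      G.comp_congr (congrArg G.one l) rfl, G.one_comp]
  rw [← aux μ h, G.comp_congr rfl e, aux ν k]

theorem eq_of_comp_inv_eq_one {γ μ : G.Arr} (h : G.r γ = G.s (G.inv μ)) {x : G.Obj}
    (e : G.comp γ (G.inv μ) h = G.one x) : γ = μ := by
  have hx : x = G.s μ := by
    rw [← G.r_one x, ← e, G.r_comp, G.r_inv]
  subst hx
  have h' : G.r γ = G.r μ := h.trans (G.s_inv μ)
  calc γ = G.comp γ (G.one (G.r γ)) (G.s_one _).symm := (G.comp_one γ).symm
    _ = G.comp γ (G.comp (G.inv μ) μ (G.r_inv μ)) (by rw [G.s_comp, h]) :=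
      G.comp_congr rfl ((congrArg G.one h').trans (G.inv_comp μ).symm) _
    _ = G.comp (G.comp γ (G.inv μ) h) μ (by rw [G.r_comp, G.r_inv]) := (G.assoc _ _ _ _ _).symm
    _ = μ := by rw [G.comp_congr e rfl, G.one_comp]

/-- In a separated groupoid, limits of arrows with the same source and range agree. -/
theorem IsSeparated.limit_unique (hG : G.IsSeparated) {ι : Type*} {F : Filter ι} [F.NeBot]
    {v : ι → G.Arr} {γ μ : G.Arr} (hγ : Filter.Tendsto v F (nhds γ))
    (hμ : Filter.Tendsto v F (nhds μ)) (hr : G.r γ = G.r μ) : γ = μ := by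
  have h : G.r γ = G.s (G.inv μ) := by rw [G.s_inv, hr]
  -- Each product of `v i` with its own inverse is a unit. These products tend to the product of `γ`
  -- with the inverse of `μ`, which is a unit because the units form a closed set.
  have hc : Filter.Tendsto (fun i => G.comp (v i) (G.inv (v i)) (G.s_inv _).symm) F
      (nhds (G.comp γ (G.inv μ) h)) := by
    have h1 : Filter.Tendsto (fun i => (⟨(v i, G.inv (v i)), (G.s_inv _).symm⟩ :
        {c : G.Arr × G.Arr // G.r c.1 = G.s c.2})) F (nhds ⟨(γ, G.inv μ), h⟩) :=
      tendsto_subtype_rng.2 (hγ.prodMk_nhds ((G.inv.hom.continuous.tendsto μ).comp hμ))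
    exact (G.continuous_comp.tendsto _).comp h1
  have hcl : IsClosed (Set.range G.one) := by
    rw [← Set.image_univ]
    exact hG _ isClosed_univ
  obtain ⟨x, hx⟩ := hcl.mem_of_tendsto hc
    (Filter.Eventually.of_forall fun i => ⟨G.s (v i), (G.comp_inv _).symm⟩)
  exact eq_of_comp_inv_eq_one h hx.symm

/-! ### The loop groupoid -/

variable (G) in
/-- The space of loops of a topological groupoid. -/
abbrev LoopSpace : Type u := {γ : G.Arr // G.s γ = G.r γ}

variable (G) in
/-- The space of pairs of a loop and an arrow with the same source. -/
abbrev LoopArr : Type u := {c : G.LoopSpace × G.Arr // G.s c.2 = G.s c.1.1}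

variable (γ : G.LoopSpace) (δ : G.Arr) (h : G.s δ = G.s γ.1) in
/-- The conjugate of a loop by an arrow. -/
def conjLoop : G.LoopSpace :=
  ⟨G.comp (G.inv δ) (G.comp γ.1 δ (by rw [← γ.2, h])) (by rw [G.r_inv, G.s_comp, h]), by
    rw [G.s_comp, G.s_inv, G.r_comp, G.r_comp]⟩

variable {γ : G.LoopSpace} {δ : G.Arr} {h : G.s δ = G.s γ.1}

theorem s_conjLoop : G.s (conjLoop γ δ h).1 = G.r δ := by
  rw [conjLoop, G.s_comp, G.s_inv]

theorem r_conjLoop : G.r (conjLoop γ δ h).1 = G.r δ := by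
  rw [← (conjLoop γ δ h).2, s_conjLoop]

theorem comp_conjLoop :
    G.comp δ (conjLoop γ δ h).1 s_conjLoop.symm = G.comp γ.1 δ (by rw [← γ.2, h]) := by
  unfold conjLoop
  rw [← G.assoc _ _ _ (G.s_inv δ).symm, G.comp_congr (G.comp_inv δ) rfl, one_comp_of_eq]

/-- By left cancellation the intertwining relation characterises the conjugate; the identities for
conjugates are proved from it rather than from the formula. -/
theorem conjLoop_unique {ν : G.LoopSpace} (hν : G.r δ = G.s ν.1)
    (e : G.comp δ ν.1 hν = G.comp γ.1 δ (by rw [← γ.2, h])) : conjLoop γ δ h = ν :=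
  Subtype.ext (comp_left_cancel s_conjLoop.symm hν (comp_conjLoop.trans e.symm))

theorem conjLoop_one (e : G.s (G.one (G.s γ.1)) = G.s γ.1) :
    conjLoop γ (G.one (G.s γ.1)) e = γ :=
  conjLoop_unique (G.r_one _) (by rw [one_comp_of_eq, comp_one_of_eq])

theorem conjLoop_inv (e : G.s (G.inv δ) = G.s (conjLoop γ δ h).1) :
    conjLoop (conjLoop γ δ h) (G.inv δ) e = γ := by
  refine conjLoop_unique (by rw [G.r_inv, h]) (comp_left_cancel (γ := δ) ?_ ?_ ?_)
  · rw [G.s_comp, G.s_inv]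
  · rw [G.s_comp, s_conjLoop]
  · rw [← G.assoc _ _ _ (G.s_inv δ).symm, G.comp_congr (G.comp_inv δ) rfl, one_comp_of_eq,
      ← G.assoc _ _ _ s_conjLoop.symm, G.comp_congr (comp_conjLoop (h := h)) rfl,
      G.assoc _ _ _ _ (G.s_inv δ).symm, G.comp_congr rfl (G.comp_inv δ), comp_one_of_eq]

theorem conjLoop_comp {μ : G.Arr} (k : G.r δ = G.s μ) (e : G.s μ = G.s (conjLoop γ δ h).1)
    (e' : G.s (G.comp δ μ k) = G.s γ.1) :
    conjLoop γ (G.comp δ μ k) e' = conjLoop (conjLoop γ δ h) μ e := by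
  refine conjLoop_unique (by rw [G.r_comp, s_conjLoop]) ?_
  rw [G.assoc _ _ _ k s_conjLoop.symm, G.comp_congr rfl (comp_conjLoop (h := e)), ← G.assoc _ _ _ s_conjLoop.symm,
    G.comp_congr (comp_conjLoop (h := h)) rfl, G.assoc]

theorem continuous_comp_of {ι : Type*} [TopologicalSpace ι] {v w : ι → G.Arr} (hv : Continuous v)
    (hw : Continuous w) (e : ∀ i, G.r (v i) = G.s (w i)) :
    Continuous fun i => G.comp (v i) (w i) (e i) :=
  G.continuous_comp.comp ((hv.prodMk hw).subtype_mk e)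

theorem continuous_conjLoop :
    Continuous fun c : G.LoopArr => conjLoop c.1.1 c.1.2 c.2 := by
  refine Continuous.subtype_mk ?_ _
  have h1 : Continuous fun c : G.LoopArr => c.1.1.1 :=
    continuous_subtype_val.comp (continuous_fst.comp continuous_subtype_val)
  have h2 : Continuous fun c : G.LoopArr => c.1.2 := continuous_snd.comp continuous_subtype_val
  exact continuous_comp_of (G.inv.hom.continuous.comp h2) (continuous_comp_of h1 h2 _) _

/-- The identity of a loop in the loop groupoid. -/
def loopOne (γ : G.LoopSpace) : G.LoopArr := ⟨(γ, G.one (G.s γ.1)), G.s_one _⟩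

/-- The inverse of an arrow in the loop groupoid. -/
def loopInv (c : G.LoopArr) : G.LoopArr :=
  ⟨(conjLoop c.1.1 c.1.2 c.2, G.inv c.1.2), (G.s_inv _).trans (s_conjLoop (h := c.2)).symm⟩

/-- The composition of arrows in the loop groupoid. -/
def loopComp (c d : G.LoopArr) (h : conjLoop c.1.1 c.1.2 c.2 = d.1.1) : G.LoopArr :=
  ⟨(c.1.1, G.comp c.1.2 d.1.2
    (((s_conjLoop (h := c.2)).symm.trans (congrArg (fun ν : G.LoopSpace => G.s ν.1) h)).trans
      d.2.symm)), (G.s_comp _ _ _).trans c.2⟩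

theorem conjLoop_loopOne (γ : G.LoopSpace) :
    conjLoop (loopOne γ).1.1 (loopOne γ).1.2 (loopOne γ).2 = γ :=
  conjLoop_one _

theorem conjLoop_loopInv (c : G.LoopArr) :
    conjLoop (loopInv c).1.1 (loopInv c).1.2 (loopInv c).2 = c.1.1 :=
  conjLoop_inv (h := c.2) (loopInv c).2

theorem loopInv_loopInv (c : G.LoopArr) : loopInv (loopInv c) = c := by
  refine Subtype.ext (Prod.ext (conjLoop_loopInv c) (comp_left_cancel (γ := G.inv c.1.2)
    (G.s_inv _).symm (G.r_inv _) ?_))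
  exact (G.comp_inv _).trans ((congrArg G.one (G.s_inv _)).trans (G.inv_comp _).symm)

theorem conjLoop_loopComp (c d : G.LoopArr) (h : conjLoop c.1.1 c.1.2 c.2 = d.1.1) :
    conjLoop (loopComp c d h).1.1 (loopComp c d h).1.2 (loopComp c d h).2 =
      conjLoop d.1.1 d.1.2 d.2 := by
  obtain ⟨⟨γ, δ⟩, hc⟩ := c
  obtain ⟨⟨μ, ν⟩, hd⟩ := d
  obtain rfl : conjLoop γ δ hc = μ := h
  exact conjLoop_comp (h := hc) (hd.trans (s_conjLoop (h := hc))).symm hd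
    ((G.s_comp _ _ _).trans hc)

theorem continuous_loopOne : Continuous (loopOne : G.LoopSpace → G.LoopArr) :=
  (continuous_id.prodMk (G.one.hom.continuous.comp
    (G.s.hom.continuous.comp continuous_subtype_val))).subtype_mk _

theorem continuous_loopInv : Continuous (loopInv : G.LoopArr → G.LoopArr) :=
  (continuous_conjLoop.prodMk (G.inv.hom.continuous.comp
    (continuous_snd.comp continuous_subtype_val))).subtype_mk _

variable (G) in
/-- The loop groupoid: its objects are the loops of `G`, on which the arrows of `G` act by
conjugation. -/
def loopGroupoid : TopGroupoid.{u} where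
  Obj := TopCat.of G.LoopSpace
  Arr := TopCat.of G.LoopArr
  s := TopCat.ofHom ⟨fun c => c.1.1, continuous_fst.comp continuous_subtype_val⟩
  r := TopCat.ofHom ⟨fun c => conjLoop c.1.1 c.1.2 c.2, continuous_conjLoop⟩
  one := TopCat.ofHom ⟨loopOne, continuous_loopOne⟩
  inv := TopCat.ofHom ⟨loopInv, continuous_loopInv⟩
  comp := loopComp
  continuous_comp := by
    have h1 := continuous_subtype_val (p := fun c : G.LoopArr × G.LoopArr =>
      conjLoop c.1.1.1 c.1.1.2 c.1.2 = c.2.1.1)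
    have h2 := continuous_subtype_val.comp (continuous_fst.comp h1)
    have h3 := continuous_subtype_val.comp (continuous_snd.comp h1)
    exact ((continuous_fst.comp h2).prodMk (continuous_comp_of (continuous_snd.comp h2)
      (continuous_snd.comp h3) _)).subtype_mk _
  s_one _ := rfl
  r_one := conjLoop_loopOne
  s_inv _ := rfl
  r_inv := conjLoop_loopInv
  s_comp _ _ _ := rfl
  r_comp := conjLoop_loopComp
  one_comp c := Subtype.ext (Prod.ext rfl (one_comp_of_eq _))
  comp_one c := Subtype.ext (Prod.ext rfl (comp_one_of_eq _))
  comp_inv c := Subtype.ext (Prod.ext rfl ((G.comp_inv _).trans (congrArg G.one c.2)))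
  inv_comp c := Subtype.ext (Prod.ext rfl ((G.inv_comp _).trans (congrArg G.one (s_conjLoop (h := c.2)).symm)))
  assoc c d e h k := Subtype.ext (Prod.ext rfl (G.assoc _ _ _ _ _))

/-! ### The loop groupoid of a very proper, étale and separated groupoid -/

/-- Local homeomorphisms are stable under base change: openness and local injectivity of `f` both
pass to the projection of the fibre product. -/
theorem isLocalHomeomorph_of_pullback {B E F : Type*} [TopologicalSpace B] [TopologicalSpace E]
    [TopologicalSpace F] {f : E → B} (hf : IsLocalHomeomorph f) {g : F → B} (hg : Continuous g) :
    IsLocalHomeomorph (fun c : {c : F × E // f c.2 = g c.1} => c.1.1) := by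
  have hcont : Continuous (fun c : {c : F × E // f c.2 = g c.1} => c.1.1) :=
    continuous_fst.comp continuous_subtype_val
  have hopen : IsOpenMap (fun c : {c : F × E // f c.2 = g c.1} => c.1.1) := by
    rw [isOpenMap_iff_nhds_le]
    rintro ⟨⟨y, x⟩, hxy : f x = g y⟩
    intro N hN
    rw [Filter.mem_map, nhds_subtype_eq_comap, nhds_prod_eq, Filter.mem_comap] at hN
    obtain ⟨M, hM, hMN⟩ := hN
    obtain ⟨P, hP, Q, hQ, hPQ⟩ := Filter.mem_prod_iff.1 hM
    have h1 : g ⁻¹' (f '' Q) ∈ nhds y :=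
      hg.continuousAt.preimage_mem_nhds (hxy ▸ hf.isOpenMap.image_mem_nhds hQ)
    filter_upwards [hP, h1] with y' hy' hy''
    obtain ⟨x', hx', e⟩ := hy''
    exact hMN (a := ⟨(y', x'), e⟩) (hPQ ⟨hy', hx'⟩)
  rw [isLocalHomeomorph_iff_isOpenEmbedding_restrict]
  rintro ⟨⟨y, x⟩, hxy⟩
  obtain ⟨U, hU, hxU, hinj⟩ := hf.isLocallyInjective x
  have hV : IsOpen {c : {c : F × E // f c.2 = g c.1} | c.1.2 ∈ U} :=
    hU.preimage (continuous_snd.comp continuous_subtype_val)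
  refine ⟨_, hV.mem_nhds hxU, .of_continuous_injective_isOpenMap
    (hcont.comp continuous_subtype_val) ?_ (hopen.domRestrict hV)⟩
  rintro ⟨⟨⟨y₁, x₁⟩, h₁⟩, hx₁⟩ ⟨⟨⟨y₂, x₂⟩, h₂⟩, hx₂⟩ (rfl : y₁ = y₂)
  obtain rfl := hinj hx₁ hx₂ (h₁.trans h₂.symm)
  rfl

theorem continuous_loopSource : Continuous fun γ : G.LoopSpace => G.s γ.1 :=
  G.s.hom.continuous.comp continuous_subtype_val

/-- The source map is the base change of `G.s` along the base point map, and the range map is the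
source map after inversion, which is a homeomorphism. -/
theorem IsEtale.loopGroupoid (hG : G.IsEtale) : G.loopGroupoid.IsEtale := by
  have hs : IsLocalHomeomorph G.loopGroupoid.s :=
    isLocalHomeomorph_of_pullback hG.1 continuous_loopSource
  refine ⟨hs, ?_⟩
  let e : G.loopGroupoid.Arr ≃ₜ G.loopGroupoid.Arr :=
    { toFun := G.loopGroupoid.inv
      invFun := G.loopGroupoid.inv
      left_inv := loopInv_loopInv
      right_inv := loopInv_loopInv
      continuous_toFun := G.loopGroupoid.inv.hom.continuous
      continuous_invFun := G.loopGroupoid.inv.hom.continuous }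
  exact hs.comp (g := G.loopGroupoid.s) e.isLocalHomeomorph

/-- The identity map is an embedding, being split by the source map, and its image is the preimage
of the closed set of units of `G`. -/
theorem IsSeparated.loopGroupoid (hG : G.IsSeparated) : G.loopGroupoid.IsSeparated := by
  refine Topology.IsClosedEmbedding.isClosedMap ⟨Topology.IsEmbedding.of_leftInverse
    (f := G.loopGroupoid.s) G.loopGroupoid.s_one G.loopGroupoid.s.hom.continuous
    G.loopGroupoid.one.hom.continuous, ?_⟩
  have hcl : IsClosed (Set.range G.one) := by
    rw [← Set.image_univ]
    exact hG _ isClosed_univ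
  have : Set.range G.loopGroupoid.one = {c : G.LoopArr | c.1.2 ∈ Set.range G.one} := by
    ext c
    constructor
    · rintro ⟨γ, rfl⟩
      exact ⟨_, rfl⟩
    · rintro ⟨x, hx⟩
      refine ⟨c.1.1, Subtype.ext (Prod.ext rfl ?_)⟩
      change G.one (G.s c.1.1.1) = c.1.2
      rw [← c.2, ← hx, G.s_one]
  rw [this]
  exact hcl.preimage (continuous_snd.comp continuous_subtype_val)

/-- Along an ultrafilter whose source and range loops converge to `γ` and `μ`, properness of `G`
gives a limit `δ` of the conjugating arrows. The conjugate of `γ` by `δ` and the loop `μ` are then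
limits of the same arrows with the same range, so separatedness identifies them. -/
theorem IsProper.loopGroupoid (hG : G.IsProper) (hS : G.IsSeparated) :
    G.loopGroupoid.IsProper := by
  refine isProperMap_iff_ultrafilter.2 ⟨G.loopGroupoid.s.hom.continuous.prodMk
    G.loopGroupoid.r.hom.continuous, ?_⟩
  rintro (𝒰 : Ultrafilter G.LoopArr) ⟨(γ : G.LoopSpace), (μ : G.LoopSpace)⟩ h𝒰
  have hs : Filter.Tendsto (fun c : G.LoopArr => c.1.1) 𝒰 (nhds γ) :=
    (continuous_fst.tendsto _).comp h𝒰
  have hr : Filter.Tendsto (fun c : G.LoopArr => conjLoop c.1.1 c.1.2 c.2) 𝒰 (nhds μ) :=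
    (continuous_snd.tendsto _).comp h𝒰
  have hd : Filter.Tendsto (fun δ : G.Arr => (G.s δ, G.r δ))
      (𝒰.map fun c : G.LoopArr => c.1.2 : Ultrafilter G.Arr) (nhds (G.s γ.1, G.s μ.1)) := by
    have := (continuous_loopSource.tendsto γ).comp hs |>.prodMk_nhds
      ((continuous_loopSource.tendsto μ).comp hr)
    exact Filter.Tendsto.congr (f₂ := fun c : G.LoopArr => (G.s c.1.2, G.r c.1.2))
      (fun c => Prod.ext c.2.symm (s_conjLoop (h := c.2))) this
  obtain ⟨δ, hδ, hle⟩ := hG.ultrafilter_le_nhds_of_tendsto hd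
  have hδs : G.s δ = G.s γ.1 := congrArg Prod.fst hδ
  have hδr : G.r δ = G.s μ.1 := congrArg Prod.snd hδ
  have hc : Filter.Tendsto id (𝒰 : Filter G.LoopArr) (nhds ⟨(γ, δ), hδs⟩) :=
    tendsto_subtype_rng.2 (hs.prodMk_nhds hle)
  refine ⟨⟨(γ, δ), hδs⟩, Prod.ext rfl (Subtype.ext ?_), hc⟩
  have h1 : Filter.Tendsto (fun c : G.LoopArr => (conjLoop c.1.1 c.1.2 c.2).1) 𝒰
      (nhds (conjLoop γ δ hδs).1) :=
    ((continuous_subtype_val.comp continuous_conjLoop).tendsto _).comp hc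
  have h2 : Filter.Tendsto (fun c : G.LoopArr => (conjLoop c.1.1 c.1.2 c.2).1) 𝒰 (nhds μ.1) :=
    (continuous_subtype_val.tendsto _).comp hr
  exact (hS.limit_unique h1 h2 (r_conjLoop.trans (hδr.trans μ.2)) :)

/-- An arrow with range the base point of a loop determines an arrow of the loop groupoid with
this loop as range. -/
def loopArrOfRange (μ : G.LoopSpace) (δ : G.Arr) (h : G.r δ = G.s μ.1) : G.LoopArr :=
  ⟨(conjLoop μ (G.inv δ) (by rw [G.s_inv, h]), δ), by rw [s_conjLoop, G.r_inv]⟩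

theorem conjLoop_conjLoop_inv {μ : G.LoopSpace} {δ : G.Arr} (h : G.r δ = G.s μ.1)
    (h₁ : G.s (G.inv δ) = G.s μ.1) (h₂ : G.s δ = G.s (conjLoop μ (G.inv δ) h₁).1) :
    conjLoop (conjLoop μ (G.inv δ) h₁) δ h₂ = μ := by
  refine conjLoop_unique h ?_
  have h₃ : G.r (conjLoop μ (G.inv δ) h₁).1 = G.s δ := by rw [r_conjLoop, G.r_inv]
  refine comp_left_cancel (γ := G.inv δ) (by rw [G.s_comp, G.r_inv])
    (by rw [G.s_comp]; exact s_conjLoop.symm) ?_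
  rw [← G.assoc _ _ _ (G.r_inv δ), G.comp_congr (G.inv_comp δ) rfl, one_comp_of_eq]
  refine Eq.trans ?_ (G.assoc _ _ _ s_conjLoop.symm h₃)
  rw [G.comp_congr (comp_conjLoop (h := h₁)) rfl, G.assoc _ _ _ _ (G.r_inv δ),
    G.comp_congr rfl (G.inv_comp δ), comp_one_of_eq]

theorem r_loopArrOfRange (μ : G.LoopSpace) (δ : G.Arr) (h : G.r δ = G.s μ.1) :
    G.loopGroupoid.r (loopArrOfRange μ δ h) = μ :=
  conjLoop_conjLoop_inv h ((G.s_inv _).trans h) (loopArrOfRange μ δ h).2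

theorem loopArrOfRange_r (c : G.LoopArr) :
    loopArrOfRange (conjLoop c.1.1 c.1.2 c.2) c.1.2 s_conjLoop.symm = c :=
  Subtype.ext (Prod.ext (conjLoop_inv (h := c.2) (by rw [s_conjLoop, G.s_inv])) rfl)

theorem IsVeryProper.loopGroupoid (hG : G.IsVeryProper) (hS : G.IsSeparated) :
    G.loopGroupoid.IsVeryProper := by
  obtain ⟨hp, he, χ, hχ, hsupp, hsum⟩ := hG
  refine ⟨hp.loopGroupoid hS, he.loopGroupoid,
    ⟨fun γ : G.LoopSpace => χ (G.s γ.1), χ.continuous.comp continuous_loopSource⟩,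
    fun γ => hχ _, ?_, fun μ => ?_⟩
  · set K := tsupport fun c : G.loopGroupoid.Arr => χ (G.s (G.loopGroupoid.s c).1) with hK
    -- The base point of the source loop is the source of the underlying arrow, so the support lies
    -- over that of the pulled-back cut-off on `G`, where the range map is proper.
    have hKsub (c : G.LoopArr) (hc : c ∈ K) :
        c.1.2 ∈ tsupport fun δ : G.Arr => χ (G.s δ) := by
      have hcl : IsClosed {c : G.LoopArr | c.1.2 ∈ tsupport fun δ : G.Arr => χ (G.s δ)} :=
        (isClosed_tsupport _).preimage (continuous_snd.comp continuous_subtype_val)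
      refine closure_minimal (t := {c : G.LoopArr | c.1.2 ∈ tsupport fun δ : G.Arr => χ (G.s δ)})
        (fun (d : G.LoopArr) (hd : χ (G.s d.1.1.1) ≠ 0) =>
        subset_tsupport _ ?_) hcl hc
      rw [Function.mem_support, d.2]
      exact hd
    refine isProperMap_iff_ultrafilter.2 ⟨G.loopGroupoid.r.hom.continuous.comp
      continuous_subtype_val, ?_⟩
    rintro 𝒰 (μ : G.LoopSpace) h𝒰
    have hr : Filter.Tendsto (fun c : K => conjLoop c.1.1.1 c.1.1.2 c.1.2) 𝒰 (nhds μ) := h𝒰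
    have hd : Filter.Tendsto (fun δ : tsupport (fun δ : G.Arr => χ (G.s δ)) => G.r δ.1)
        (𝒰.map fun c : K => ⟨c.1.1.2, hKsub c.1 c.2⟩ : Ultrafilter (tsupport _)) (nhds (G.s μ.1)) := by
      exact Filter.Tendsto.congr (f₂ := fun c : K => G.r c.1.1.2)
        (fun c => s_conjLoop (h := c.1.2)) ((continuous_loopSource.tendsto μ).comp hr)
    obtain ⟨δ, hδ, hle⟩ := hsupp.ultrafilter_le_nhds_of_tendsto hd
    have hle' : Filter.Tendsto (fun c : K => c.1.1.2) 𝒰 (nhds δ.1) :=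
      (continuous_subtype_val.tendsto _).comp hle
    -- The source loop is the conjugate of the range loop by the inverse arrow, so it converges once
    -- these two do.
    have hc : Filter.Tendsto (fun c : K => c.1) 𝒰 (nhds (loopArrOfRange μ δ.1 hδ)) := by
      refine tendsto_subtype_rng.2 (Filter.Tendsto.prodMk_nhds ?_ hle')
      have h1 : Filter.Tendsto (fun c : K => (⟨(conjLoop c.1.1.1 c.1.1.2 c.1.2,
          G.inv c.1.1.2), by rw [s_conjLoop, G.s_inv]⟩ : G.LoopArr)) 𝒰
          (nhds ⟨(μ, G.inv δ.1), by rw [G.s_inv, hδ]⟩) :=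
        tendsto_subtype_rng.2 (hr.prodMk_nhds ((G.inv.hom.continuous.tendsto _).comp hle'))
      refine ((continuous_conjLoop.tendsto _).comp h1).congr fun c => ?_
      exact conjLoop_loopInv c.1
    have hmem : loopArrOfRange μ δ.1 hδ ∈ K :=
      (isClosed_tsupport _).mem_of_tendsto hc (Filter.Eventually.of_forall fun c => c.2)
    exact ⟨⟨_, hmem⟩, r_loopArrOfRange _ _ hδ, tendsto_subtype_rng (f := id).2 hc⟩
  -- An arrow of the loop groupoid with range `μ` is determined by its underlying arrow, so the sum
  -- over the fibre of `μ` is the sum for `G` at the base point of `μ`.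
  · let e : {c : G.LoopArr // G.loopGroupoid.r c = μ} ≃ {δ : G.Arr // G.r δ = G.s μ.1} :=
      { toFun := fun c => ⟨c.1.1.2, (s_conjLoop (h := c.1.2)).symm.trans
          (congrArg (fun ν : G.LoopSpace => G.s ν.1) c.2)⟩
        invFun := fun δ => ⟨loopArrOfRange μ δ.1 δ.2, r_loopArrOfRange _ _ _⟩
        left_inv := by
          rintro ⟨c, rfl⟩
          exact Subtype.ext (loopArrOfRange_r c)
        right_inv := fun _ => rfl }
    have h1 := e.hasSum_iff.2 (hsum (G.s μ.1))
    have h2 : (fun c : {c : G.LoopArr // G.loopGroupoid.r c = μ} => χ (G.s c.1.1.2)) =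
        fun c => χ (G.s c.1.1.1.1) := funext fun c => congrArg χ c.1.2
    exact h2 ▸ h1

end TopGroupoid

end Orbispace

namespace Orbispace

namespace TopGroupoid

/-! ## The atlas of the loop stack -/

section Arrows

variable {G : TopGroupoid.{u}} {X : Prestack.{u}} {a : space G.Obj ⟶ X} {U V : TopCat.{u}}

/-- The isomorphism of the families of sources and ranges of a family of arrows. -/
def arrSq (θ : spaceMap G.s ≫ a ≅ spaceMap G.r ≫ a) (γ : U ⟶ G.Arr) :
    sec a (γ ≫ G.s) ≅ sec a (γ ≫ G.r) :=
  sqIso θ γ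

/-- The isomorphism of families which is represented by a family of arrows. -/
def arrIso (θ : spaceMap G.s ≫ a ≅ spaceMap G.r ≫ a) (γ : U ⟶ G.Arr) {m n : U ⟶ G.Obj}
    (hm : m = γ ≫ G.s) (hn : γ ≫ G.r = n) : sec a m ≅ sec a n :=
  secEq a hm ≪≫ arrSq θ γ ≪≫ secEq a hn

variable {θ : spaceMap G.s ≫ a ≅ spaceMap G.r ≫ a}

theorem secEq_arrIso {γ : U ⟶ G.Arr} {m m' n : U ⟶ G.Obj} (hm : m = γ ≫ G.s) (hn : γ ≫ G.r = n)
    (h : m' = m) : (secEq a h).hom ≫ (arrIso θ γ hm hn).hom =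
      (arrIso θ γ (h.trans hm) hn).hom := by
  subst h
  simp

theorem arrIso_secEq {γ : U ⟶ G.Arr} {m n n' : U ⟶ G.Obj} (hm : m = γ ≫ G.s) (hn : γ ≫ G.r = n)
    (h : n = n') : (arrIso θ γ hm hn).hom ≫ (secEq a h).hom =
      (arrIso θ γ hm (hn.trans h)).hom := by
  subst h
  simp

theorem res_arrIso (g : V ⟶ U) {γ : U ⟶ G.Arr} {m n : U ⟶ G.Obj} {m' n' : V ⟶ G.Obj}
    (hm : m = γ ≫ G.s) (hn : γ ≫ G.r = n) (hm' : m' = g ≫ m) (hn' : n' = g ≫ n) :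
    res g hm' hn' (arrIso θ γ hm hn).hom = (arrIso θ (g ≫ γ) (by rw [hm', hm, Category.assoc])
      (by rw [hn', ← hn, Category.assoc])).hom := by
  subst hm hn hm' hn'
  simp only [arrIso, secEq_rfl, Iso.refl_trans, Iso.trans_refl]
  exact res_sqIso θ g γ

/-- The existence half of the universal property of `G.Arr` as a fibre product; `arrIso_injective`
is the uniqueness half. -/
theorem arrIso_surjective (hθ : IsTwoCartesian θ) {m n : U ⟶ G.Obj} (ψ : sec a m ≅ sec a n) :
    ∃ (γ : U ⟶ G.Arr) (hm : m = γ ≫ G.s) (hn : γ ≫ G.r = n), arrIso θ γ hm hn = ψ := by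
  obtain ⟨γ, ⟨h₁, h₂, h₃⟩, -⟩ := (isTwoCartesian_iff θ).1 hθ U m n ψ
  subst h₁
  refine ⟨γ, rfl, h₂, ?_⟩
  ext
  simp only [secEq_rfl, Iso.refl_hom, Category.id_comp] at h₃
  simp only [arrIso, secEq_rfl, Iso.refl_trans, Iso.trans_hom]
  exact h₃.symm

theorem arrIso_injective (hθ : IsTwoCartesian θ) {γ μ : U ⟶ G.Arr} {m n : U ⟶ G.Obj}
    {hm : m = γ ≫ G.s} {hn : γ ≫ G.r = n} {hm' : m = μ ≫ G.s} {hn' : μ ≫ G.r = n}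
    (h : (arrIso θ γ hm hn).hom = (arrIso θ μ hm' hn').hom) : γ = μ := by
  refine ((isTwoCartesian_iff θ).1 hθ U m n (arrIso θ γ hm hn)).unique
    ⟨hm.symm, hn, ?_⟩ ⟨hm'.symm, hn', ?_⟩
  · simp only [arrIso, Iso.trans_hom, secEq_trans_assoc]
    simp [arrSq]
  · rw [h]
    simp only [arrIso, Iso.trans_hom, secEq_trans_assoc]
    simp [arrSq]

end Arrows

section LoopAtlas

variable {G : TopGroupoid.{u}} {X : Prestack.{u}} {a : space G.Obj ⟶ X} {T Z U V : TopCat.{u}}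

variable (G) in
/-- The inclusion of the loops into the arrows. -/
def loopIncl : G.loopGroupoid.Obj ⟶ G.Arr :=
  TopCat.ofHom ⟨fun γ : G.LoopSpace => γ.1, continuous_subtype_val⟩

variable (G) in
/-- The base point of a loop. -/
def loopPt : G.loopGroupoid.Obj ⟶ G.Obj := G.loopIncl ≫ G.s

variable (G) in
theorem loopIncl_r : G.loopIncl ≫ G.r = G.loopPt := by
  ext γ
  exact (Subtype.prop (p := fun γ : G.Arr => G.s γ = G.r γ) γ).symm

theorem comp_loopIncl_s (z : U ⟶ G.loopGroupoid.Obj) :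
    (z ≫ G.loopIncl) ≫ G.s = z ≫ G.loopPt := Category.assoc _ _ _

theorem comp_loopIncl_r (z : U ⟶ G.loopGroupoid.Obj) :
    (z ≫ G.loopIncl) ≫ G.r = z ≫ G.loopPt := by
  rw [Category.assoc, loopIncl_r]

theorem loopIncl_cancel {y z : U ⟶ G.loopGroupoid.Obj} (h : y ≫ G.loopIncl = z ≫ G.loopIncl) :
    y = z := by
  ext x
  exact Subtype.ext (congrArg (fun k : U ⟶ G.Arr => k x) h)

/-- A family of arrows with equal source and range is a family of loops. -/
theorem exists_loop (γ : U ⟶ G.Arr) (h : γ ≫ G.s = γ ≫ G.r) :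
    ∃ z : U ⟶ G.loopGroupoid.Obj, z ≫ G.loopIncl = γ :=
  ⟨TopCat.ofHom ⟨fun x => (⟨γ x, congrArg (fun k : U ⟶ G.Obj => k x) h⟩ : G.LoopSpace),
    γ.hom.continuous.subtype_mk _⟩, rfl⟩

/-- The tautological automorphisms over the space of loops. -/
def loopArr (θ : spaceMap G.s ≫ a ≅ spaceMap G.r ≫ a) (U : TopCat.{u})
    (z : U ⟶ G.loopGroupoid.Obj) : sec a (z ≫ G.loopPt) ≅ sec a (z ≫ G.loopPt) :=
  arrIso θ (z ≫ G.loopIncl) (comp_loopIncl_s z).symm (comp_loopIncl_r z)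

theorem res_loopArr (θ : spaceMap G.s ≫ a ≅ spaceMap G.r ≫ a) (g : V ⟶ U)
    (z : U ⟶ G.loopGroupoid.Obj) :
    res g (Category.assoc g z G.loopPt) (Category.assoc g z G.loopPt) (loopArr θ U z).hom =
      (loopArr θ V (g ≫ z)).hom :=
  res_arrIso g _ _ _ _

/-- The atlas of the loop stack: the space of loops with the tautological automorphism. -/
def loopAtlas (θ : spaceMap G.s ≫ a ≅ spaceMap G.r ≫ a) :
    space G.loopGroupoid.Obj ⟶ loopStack X :=
  loopLift G.loopPt a (loopArr θ) (res_loopArr θ)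

variable {θ : spaceMap G.s ≫ a ≅ spaceMap G.r ≫ a}

/-- The components of a square over the atlas of the loop stack. -/
def atlasSq {t : space T ⟶ loopStack X} {p : Z ⟶ T} {q : space Z ⟶ space G.loopGroupoid.Obj}
    (κ : spaceMap p ≫ t ≅ q ≫ loopAtlas θ) (z : U ⟶ Z) :
    sec (base t) (z ≫ p) ≅ sec a (pt q z ≫ G.loopPt) :=
  loopSq (he := res_loopArr θ) κ z

theorem atlasSq_comm {t : space T ⟶ loopStack X} {p : Z ⟶ T}
    {q : space Z ⟶ space G.loopGroupoid.Obj}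
    (κ : spaceMap p ≫ t ≅ q ≫ loopAtlas θ) (z : U ⟶ Z) :
    (loopAut t (z ≫ p)).hom ≫ (atlasSq κ z).hom =
      (atlasSq κ z).hom ≫ (loopArr θ U (pt q z)).hom :=
  loopSq_comm (he := res_loopArr θ) κ z

/-- A square over the atlas of the loop stack, given by its components. -/
def atlasSqMk {t : space T ⟶ loopStack X} {p : Z ⟶ T} {q : space Z ⟶ space G.loopGroupoid.Obj}
    (k : ∀ (U : TopCat.{u}) (z : U ⟶ Z), sec (base t) (z ≫ p) ≅ sec a (pt q z ≫ G.loopPt))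
    (hk : ∀ (U : TopCat.{u}) (z : U ⟶ Z),
      (loopAut t (z ≫ p)).hom ≫ (k U z).hom = (k U z).hom ≫ (loopArr θ U (pt q z)).hom)
    (hk' : ∀ {U V : TopCat.{u}} (g : V ⟶ U) (z : U ⟶ Z), res g (Category.assoc g z p)
      ((congrArg (· ≫ G.loopPt) (pt_comp q g z)).trans (Category.assoc g (pt q z) G.loopPt))
        (k U z).hom = (k V (g ≫ z)).hom) :
    spaceMap p ≫ t ≅ q ≫ loopAtlas θ :=
  loopSqMk (he := res_loopArr θ) k hk hk'

theorem isTwoCartesian_atlas_iff {t : space T ⟶ loopStack X} {p : Z ⟶ T}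
    {q : space Z ⟶ space G.loopGroupoid.Obj} (κ : spaceMap p ≫ t ≅ q ≫ loopAtlas θ) :
    IsTwoCartesian κ ↔ ∀ (U : TopCat.{u}) (m : U ⟶ T) (n : U ⟶ G.loopGroupoid.Obj)
      (ψ : sec (base t) m ≅ sec a (n ≫ G.loopPt)),
      (loopAut t m).hom ≫ ψ.hom = ψ.hom ≫ (loopArr θ U n).hom →
      ∃! z : U ⟶ Z, ∃ (h₁ : z ≫ p = m) (h₂ : pt q z = n),
        (secEq (base t) h₁).hom ≫ ψ.hom =
          (atlasSq κ z).hom ≫ (secEq a (congrArg (· ≫ G.loopPt) h₂)).hom :=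
  isTwoCartesian_loop_iff (he := res_loopArr θ) κ

/-- The hypothesis says that two families of arrows represent the same isomorphism, so
`arrIso_injective` applies. -/
theorem eq_of_loopArr (hθ : IsTwoCartesian θ) {y z : U ⟶ G.loopGroupoid.Obj}
    (h : y ≫ G.loopPt = z ≫ G.loopPt)
    (e : (loopArr θ U y).hom ≫ (secEq a h).hom = (secEq a h).hom ≫ (loopArr θ U z).hom) :
    y = z := by
  rw [loopArr, loopArr, arrIso_secEq, secEq_arrIso] at e
  exact loopIncl_cancel (arrIso_injective hθ e)

/-- The family of arrows representing `ψ` has `n` both as source and as range, hence consists of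
loops. -/
theorem exists_loopArr (hθ : IsTwoCartesian θ) {n : U ⟶ G.Obj} (ψ : sec a n ≅ sec a n) :
    ∃ (z : U ⟶ G.loopGroupoid.Obj) (h : n = z ≫ G.loopPt),
      ψ.hom ≫ (secEq a h).hom = (secEq a h).hom ≫ (loopArr θ U z).hom := by
  obtain ⟨γ, hm, hn, rfl⟩ := arrIso_surjective hθ ψ
  obtain ⟨z, rfl⟩ := exists_loop γ (hm.symm.trans hn.symm)
  refine ⟨z, hm.trans (comp_loopIncl_s z), ?_⟩
  rw [loopArr, arrIso_secEq, secEq_arrIso]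

/-- A square over the loop stack is `2`-cartesian if and only if the underlying square over the
stack is `2`-cartesian. -/
theorem isTwoCartesian_loop (hθ : IsTwoCartesian θ) {t : space T ⟶ loopStack X} {p : Z ⟶ T}
    {q : space Z ⟶ space G.Obj} {q' : space Z ⟶ space G.loopGroupoid.Obj}
    (κ : spaceMap p ≫ base t ≅ q ≫ a) (κ' : spaceMap p ≫ t ≅ q' ≫ loopAtlas θ)
    (hq : ∀ {U : TopCat.{u}} (z : U ⟶ Z), pt q z = pt q' z ≫ G.loopPt)
    (hκ : ∀ {U : TopCat.{u}} (z : U ⟶ Z),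
      (sqIso κ z).hom ≫ (secEq a (hq z)).hom = (atlasSq κ' z).hom) :
    IsTwoCartesian κ ↔ IsTwoCartesian κ' := by
  -- Compatibility with the automorphisms makes the loops `pt q' z` and `n` intertwined over their
  -- common base point, so they agree: equality of base points already suffices.
  have aux {U : TopCat.{u}} (z : U ⟶ Z) {m : U ⟶ T} {n : U ⟶ G.loopGroupoid.Obj}
      (ψ : sec (base t) m ≅ sec a (n ≫ G.loopPt))
      (hψ : (loopAut t m).hom ≫ ψ.hom = ψ.hom ≫ (loopArr θ U n).hom)
      (h₁ : z ≫ p = m) (h₂ : pt q' z ≫ G.loopPt = n ≫ G.loopPt)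
      (h₃ : (secEq (base t) h₁).hom ≫ ψ.hom = (atlasSq κ' z).hom ≫ (secEq a h₂).hom) :
      pt q' z = n := by
    subst h₁
    simp only [secEq_rfl, Iso.refl_hom, Category.id_comp] at h₃
    refine eq_of_loopArr hθ h₂ ?_
    rw [← cancel_epi (atlasSq κ' z).hom, ← Category.assoc, ← atlasSq_comm, Category.assoc, ← h₃, hψ,
      h₃, Category.assoc]
  rw [isTwoCartesian_iff]
  refine Iff.trans ?_ (isTwoCartesian_atlas_iff κ').symm
  constructor
  · intro h U m n ψ hψ
    obtain ⟨z, ⟨h₁, h₂, h₃⟩, hz⟩ := h U m (n ≫ G.loopPt) ψ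
    have h₂' : pt q' z ≫ G.loopPt = n ≫ G.loopPt := (hq z).symm.trans h₂
    have h₃' : (secEq (base t) h₁).hom ≫ ψ.hom = (atlasSq κ' z).hom ≫ (secEq a h₂').hom := by
      rw [h₃, ← hκ, Category.assoc, secEq_trans]
    refine ⟨z, ⟨h₁, aux z ψ hψ h₁ h₂' h₃', h₃'⟩, ?_⟩
    rintro y ⟨k₁, k₂, k₃⟩
    refine hz y ⟨k₁, (hq y).trans (congrArg (· ≫ G.loopPt) k₂), ?_⟩
    rw [k₃, ← hκ, Category.assoc, secEq_trans]
  · intro h U m n ψ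
    -- Transporting the automorphism of `t` along `ψ` yields the loop `k` over `n`, which turns the
    -- given test datum over `X` into one over the loop stack.
    obtain ⟨k, hk, e⟩ := exists_loopArr hθ (ψ.symm ≪≫ loopAut t m ≪≫ ψ)
    simp only [Iso.trans_hom, Iso.symm_hom, Category.assoc, Iso.inv_comp_eq] at e
    obtain ⟨z, ⟨h₁, h₂, h₃⟩, hz⟩ := h U m k (ψ ≪≫ secEq a hk) (by simpa using e)
    simp only [Iso.trans_hom] at h₃
    have hn : pt q z = n := by rw [hq z, h₂, hk]
    refine ⟨z, ⟨h₁, hn, ?_⟩, ?_⟩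
    · rw [← cancel_mono (secEq a hk).hom, Category.assoc, h₃, ← hκ, Category.assoc, Category.assoc,
        secEq_trans, secEq_trans]
    · rintro y ⟨k₁, k₂, k₃⟩
      have l : pt q' y ≫ G.loopPt = k ≫ G.loopPt := by rw [← hq y, k₂, hk]
      have l' : (secEq (base t) k₁).hom ≫ (ψ ≪≫ secEq a hk).hom =
          (atlasSq κ' y).hom ≫ (secEq a l).hom := by
        rw [Iso.trans_hom, reassoc_of% k₃, secEq_trans, ← hκ, Category.assoc, secEq_trans]
      exact hz y ⟨k₁, aux y (ψ ≪≫ secEq a hk) (by simpa using e) k₁ l l', l'⟩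

theorem res_loopAut_of_eq (t : space T ⟶ loopStack X) (g : V ⟶ U) {m : U ⟶ T} {m' : V ⟶ T}
    (h : m' = g ≫ m) : res g h h (loopAut t m).hom = (loopAut t m').hom := by
  subst h
  exact res_loopAut t g m

theorem res_loopArr_of_eq (θ : spaceMap G.s ≫ a ≅ spaceMap G.r ≫ a) (g : V ⟶ U)
    {z : U ⟶ G.loopGroupoid.Obj} {z' : V ⟶ G.loopGroupoid.Obj} (h : z' = g ≫ z)
    (h' : z' ≫ G.loopPt = g ≫ z ≫ G.loopPt) :
    res g h' h' (loopArr θ U z).hom = (loopArr θ V z').hom := by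
  subst h
  exact res_loopArr θ g z

theorem res_sqIso_of_eq {A : TopCat.{u}} {t : space T ⟶ X} {b : space A ⟶ X} {p : Z ⟶ T}
    {q : space Z ⟶ space A} (κ : spaceMap p ≫ t ≅ q ≫ b) (g : V ⟶ U) {z : U ⟶ Z} {z' : V ⟶ Z}
    (h : z' = g ≫ z) (h₁ : z' ≫ p = g ≫ z ≫ p) (h₂ : pt q z' = g ≫ pt q z) :
    res g h₁ h₂ (sqIso κ z).hom = (sqIso κ z').hom := by
  subst h
  exact res_sqIso κ g z

/-- The space `Z` representing the fibre product over `X` also serves over the loop stack. The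
automorphism of `t`, transported to the atlas at the universal point `𝟙 Z`, is a family of loops `y`
and supplies the missing projection. -/
theorem loopAtlas_isRepresentable (hθ : IsTwoCartesian θ) (ha : IsRepresentable a) :
    IsRepresentable (loopAtlas θ) := by
  intro T t
  obtain ⟨Z, p, q, κ, hκ⟩ := ha T (base t)
  obtain ⟨y, hy, e⟩ := exists_loopArr hθ ((sqIso κ (𝟙 Z)).symm ≪≫ loopAut t _ ≪≫ sqIso κ (𝟙 Z))
  simp only [Iso.trans_hom, Iso.symm_hom, Category.assoc, Iso.inv_comp_eq] at e
  have hq {U : TopCat.{u}} (z : U ⟶ Z) : pt q z = pt (spaceMap y) z ≫ G.loopPt := by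
    rw [pt_eq_comp, hy, pt_spaceMap, Category.assoc]
  let κ' : spaceMap p ≫ t ≅ spaceMap y ≫ loopAtlas θ :=
    atlasSqMk (fun U z => sqIso κ z ≪≫ secEq a (hq z))
      (fun U z => by
        have h₀ : z = z ≫ 𝟙 Z := (Category.comp_id z).symm
        have h₁ : z ≫ p = z ≫ 𝟙 Z ≫ p := by rw [Category.id_comp]
        have h₂ : pt q z = z ≫ pt q (𝟙 Z) := pt_eq_comp q z
        have h₃ : pt (spaceMap y) z ≫ G.loopPt = z ≫ y ≫ G.loopPt := Category.assoc _ _ _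
        have h₄ := res_loopArr_of_eq θ z (z := y) (z' := pt (spaceMap y) z) rfl h₃
        -- The relation at a general point `z` is the restriction along `z` of the relation at the
        -- universal point.
        have := congrArg (res z h₁ h₃) e
        rw [res_comp z h₁ h₁ h₃, res_comp z h₁ h₂ h₃, res_comp z h₁ h₂ h₃, res_comp z h₂ h₃ h₃,
          res_loopAut_of_eq, res_sqIso_of_eq κ z h₀, res_secEq, h₄] at this
        simpa using this)
      (fun g z => by
        have h₂ : pt q (g ≫ z) = g ≫ pt q z := pt_comp q g z
        rw [Iso.trans_hom, res_comp g _ h₂, res_sqIso, res_secEq]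
        rfl)
  exact ⟨Z, p, spaceMap y, κ', (isTwoCartesian_loop hθ κ κ' hq (fun z => rfl)).1 hκ⟩

/-- The square over `a` has the same projection `p`, and surjectivity and local sections concern `p`
alone. -/
theorem exists_base_square (hθ : IsTwoCartesian θ) {t : space T ⟶ loopStack X} {p : Z ⟶ T}
    {q : space Z ⟶ space G.loopGroupoid.Obj} (κ : spaceMap p ≫ t ≅ q ≫ loopAtlas θ)
    (hκ : IsTwoCartesian κ) :
    ∃ κ' : spaceMap p ≫ base t ≅ (q ≫ spaceMap G.loopPt) ≫ a, IsTwoCartesian κ' := by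
  let κ' : spaceMap p ≫ base t ≅ (q ≫ spaceMap G.loopPt) ≫ a :=
    sqMk (fun U z => atlasSq κ z) (fun g z => res_loopSq (he := res_loopArr θ) κ g z)
  refine ⟨κ', (isTwoCartesian_loop hθ κ' κ (fun z => rfl) (fun z => ?_)).2 hκ⟩
  exact (congrArg (fun k => (atlasSq κ z).hom ≫ k) (congrArg Iso.hom (secEq_rfl a rfl))).trans
    (Category.comp_id _)

theorem loopAtlas_isAtlas (hθ : IsTwoCartesian θ) (ha : IsAtlas a) : IsAtlas (loopAtlas θ) where
  representable := loopAtlas_isRepresentable hθ ha.representable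
  surjective κ hκ := by
    obtain ⟨κ', hκ'⟩ := exists_base_square hθ κ hκ
    exact ha.surjective κ' hκ'
  localSections κ hκ := by
    obtain ⟨κ', hκ'⟩ := exists_base_square hθ κ hκ
    exact ha.localSections κ' hκ'

/-! ### The loop groupoid as the groupoid of the loop atlas. -/

variable (G) in
/-- The arrow underlying an arrow of the loop groupoid. -/
def loopArrow : G.loopGroupoid.Arr ⟶ G.Arr :=
  TopCat.ofHom ⟨fun c : G.LoopArr => c.1.2, continuous_snd.comp continuous_subtype_val⟩

theorem comp_loopArrow_s (c : U ⟶ G.loopGroupoid.Arr) :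
    (c ≫ G.loopGroupoid.s) ≫ G.loopPt = (c ≫ G.loopArrow) ≫ G.s := by
  ext x
  exact (Subtype.prop (p := fun d : G.LoopSpace × G.Arr => G.s d.2 = G.s d.1.1) (c x)).symm

theorem comp_loopArrow_r (c : U ⟶ G.loopGroupoid.Arr) :
    (c ≫ G.loopArrow) ≫ G.r = (c ≫ G.loopGroupoid.r) ≫ G.loopPt := by
  ext x
  exact (s_conjLoop (h := Subtype.prop (p := fun d : G.LoopSpace × G.Arr =>
    G.s d.2 = G.s d.1.1) (c x))).symm

theorem loopArr_ext {c d : U ⟶ G.loopGroupoid.Arr}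
    (h₁ : c ≫ G.loopGroupoid.s = d ≫ G.loopGroupoid.s)
    (h₂ : c ≫ G.loopArrow = d ≫ G.loopArrow) : c = d := by
  ext x
  exact Subtype.ext (Prod.ext (congrArg (fun k : U ⟶ G.loopGroupoid.Obj => k x) h₁)
    (congrArg (fun k : U ⟶ G.Arr => k x) h₂))

theorem exists_loopArrow (n : U ⟶ G.loopGroupoid.Obj) (γ : U ⟶ G.Arr)
    (h : n ≫ G.loopPt = γ ≫ G.s) :
    ∃ c : U ⟶ G.loopGroupoid.Arr, c ≫ G.loopGroupoid.s = n ∧ c ≫ G.loopArrow = γ :=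
  ⟨TopCat.ofHom ⟨fun x => (⟨(n x, γ x), (congrArg (fun k : U ⟶ G.Obj => k x) h).symm⟩ : G.LoopArr),
    (n.hom.continuous.prodMk γ.hom.continuous).subtype_mk _⟩, rfl, rfl⟩

theorem IsGroupoidOf.arrIso_comp (h : G.IsGroupoidOf a θ) (γ μ ν : U ⟶ G.Arr)
    (hγμ : ∀ t, G.r (γ t) = G.s (μ t)) (hν : ∀ t, ν t = G.comp (γ t) (μ t) (hγμ t))
    {x y z : U ⟶ G.Obj} (hx : x = γ ≫ G.s) (hy : γ ≫ G.r = y) (hy' : y = μ ≫ G.s)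
    (hz : μ ≫ G.r = z) (hx' : x = ν ≫ G.s) (hz' : ν ≫ G.r = z) :
    (arrIso θ ν hx' hz').hom = (arrIso θ γ hx hy).hom ≫ (arrIso θ μ hy' hz).hom :=
  h.arrow_comp γ μ ν hγμ hν (x := ⟨x⟩) (y := ⟨y⟩) (z := ⟨z⟩) hx hy hy' hz hx' hz'

/-- Conjugate loops are intertwined by the conjugating arrow. -/
theorem IsGroupoidOf.loopArr_comm (h : G.IsGroupoidOf a θ) (c : U ⟶ G.loopGroupoid.Arr) :
    (loopArr θ U (c ≫ G.loopGroupoid.s)).hom ≫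
        (arrIso θ (c ≫ G.loopArrow) (comp_loopArrow_s c) (comp_loopArrow_r c)).hom =
      (arrIso θ (c ≫ G.loopArrow) (comp_loopArrow_s c) (comp_loopArrow_r c)).hom ≫
        (loopArr θ U (c ≫ G.loopGroupoid.r)).hom := by
  have hc (x : U) := Subtype.prop (p := fun d : G.LoopSpace × G.Arr => G.s d.2 = G.s d.1.1) (c x)
  have e₁ (x : U) : G.r (((c ≫ G.loopGroupoid.s) ≫ G.loopIncl) x) = G.s ((c ≫ G.loopArrow) x) :=
    (Subtype.prop (p := fun γ : G.Arr => G.s γ = G.r γ) (G.loopGroupoid.s (c x))).symm.trans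
      (hc x).symm
  -- Both sides are represented by the one family `ν`: it is the loop followed by the arrow by
  -- definition, and the arrow followed by the conjugate loop by `comp_conjLoop`.
  let ν : U ⟶ G.Arr := TopCat.ofHom ⟨fun x => G.comp _ _ (e₁ x),
    continuous_comp_of (TopCat.Hom.hom _).continuous (TopCat.Hom.hom _).continuous _⟩
  have h₁ : (c ≫ G.loopGroupoid.s) ≫ G.loopPt = ν ≫ G.s := by
    ext x
    exact (G.s_comp _ _ (e₁ x)).symm
  have h₂ : ν ≫ G.r = (c ≫ G.loopGroupoid.r) ≫ G.loopPt := by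
    rw [← comp_loopArrow_r]
    ext x
    exact G.r_comp _ _ (e₁ x)
  rw [loopArr, loopArr, ← h.arrIso_comp _ _ ν e₁ (fun _ => rfl) _ _ _ _ h₁ h₂,
    ← h.arrIso_comp (c ≫ G.loopArrow) ((c ≫ G.loopGroupoid.r) ≫ G.loopIncl) ν
      (fun x => (s_conjLoop (h := hc x)).symm)
      (fun x => (comp_conjLoop (h := hc x)).symm) _ _ _ _ h₁ h₂]

/-- The families underlying `loopAtlas θ` are those of `a` at the base points; this shows that their
restriction cells match too. -/
theorem res_base_loopAtlas (g : V ⟶ U) {A : TopCat.{u}} {b : space A ⟶ X}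
    {m : U ⟶ G.loopGroupoid.Obj} {m' : V ⟶ G.loopGroupoid.Obj} (hm : m' = g ≫ m)
    (hm' : m' ≫ G.loopPt = g ≫ m ≫ G.loopPt) {n : U ⟶ A} {n' : V ⟶ A}
    (hn : n' = g ≫ n) (α : sec a (m ≫ G.loopPt) ⟶ sec b n) :
    res (f := base (loopAtlas θ)) g hm hn α = res (f := a) g hm' hn α := by
  subst hm
  refine (res_iff _ _ _ _ _).2 ?_
  rw [secNat_base]
  refine Eq.trans ?_ (congrArg (fun k => k ≫ (X.map g.op.toLoc).toFunctor.map α)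
    (secNat_loopLift (he := res_loopArr θ) g m).symm)
  exact (res_iff _ _ _ _ _).1 rfl

/-- The square which exhibits the loop groupoid as the groupoid of the atlas of the loop stack. -/
def loopGroupoidSq (h : G.IsGroupoidOf a θ) :
    spaceMap G.loopGroupoid.s ≫ loopAtlas θ ≅ spaceMap G.loopGroupoid.r ≫ loopAtlas θ :=
  atlasSqMk (t := loopAtlas θ) (q := spaceMap G.loopGroupoid.r)
    (fun U c => arrIso θ (c ≫ G.loopArrow) (comp_loopArrow_s c) (comp_loopArrow_r c))
    (fun U c => h.loopArr_comm c)
    (fun g c => by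
      refine (res_base_loopAtlas g _ rfl _ _).trans ?_
      exact res_arrIso g _ _ _ _)

theorem arrow_loopGroupoidSq (h : G.IsGroupoidOf a θ) (c : U ⟶ G.loopGroupoid.Arr)
    {y z : Points G.loopGroupoid.Obj U} (hy : y.map = c ≫ G.loopGroupoid.s)
    (hz : c ≫ G.loopGroupoid.r = z.map) :
    Loop.Hom.hom (C := X.obj (site U)) (arrow (loopGroupoidSq h) c hy hz) =
      (arrIso θ (c ≫ G.loopArrow)
        ((congrArg (fun m => m ≫ G.loopPt) hy).trans (comp_loopArrow_s c))
        ((comp_loopArrow_r c).trans (congrArg (fun m => m ≫ G.loopPt) hz))).hom := by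
  have e : Loop.Hom.hom (C := X.obj (site U)) (arrow (loopGroupoidSq h) c hy hz) =
      (secEq a (congrArg (fun m => m ≫ G.loopPt) hy)).hom ≫
        (arrIso θ (c ≫ G.loopArrow) (comp_loopArrow_s c) (comp_loopArrow_r c)).hom ≫
        (secEq a (congrArg (fun m => m ≫ G.loopPt) hz)).hom := rfl
  rw [e, arrIso_secEq]
  exact secEq_arrIso _ _ _

theorem loopGroupoid_isGroupoidOf (h : G.IsGroupoidOf a θ) :
    G.loopGroupoid.IsGroupoidOf (loopAtlas θ) (loopGroupoidSq h) where
  isTwoCartesian := by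
    refine (isTwoCartesian_atlas_iff (t := loopAtlas θ) (q := spaceMap G.loopGroupoid.r) _).2 ?_
    intro U m n (ψ : sec a (m ≫ G.loopPt) ≅ sec a (n ≫ G.loopPt))
      (hψ : (loopArr θ U m).hom ≫ ψ.hom = ψ.hom ≫ (loopArr θ U n).hom)
    obtain ⟨γ, hm, hn, rfl⟩ := arrIso_surjective h.isTwoCartesian ψ
    obtain ⟨c, rfl, rfl⟩ := exists_loopArrow m γ hm
    have hr := (comp_loopArrow_r c).symm.trans hn
    -- The isomorphism given by `c` intertwines the source loop both with its conjugate and with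
    -- `n`, so these two loops coincide.
    have h₂ : c ≫ G.loopGroupoid.r = n := by
      have e := arrIso_secEq (θ := θ) (comp_loopArrow_s c) (comp_loopArrow_r c) hr
      refine eq_of_loopArr h.isTwoCartesian hr ?_
      have key {C : Type (u + 1)} [Category.{u} C] {P Q R : C} {k : P ⟶ P} {l : Q ⟶ Q} {k' : R ⟶ R}
          {f : P ⟶ Q} {f' : Q ⟶ R} {f'' : P ⟶ R} [IsIso f] (h₁ : k ≫ f = f ≫ l)
          (h₂ : f ≫ f' = f'') (h₃ : k ≫ f'' = f'' ≫ k') : l ≫ f' = f' ≫ k' := by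
        rw [← cancel_epi f, ← reassoc_of% h₁, h₂, h₃, ← h₂, Category.assoc]
      exact key (h.loopArr_comm c) e hψ
    subst h₂
    refine ⟨c, ⟨rfl, rfl, ?_⟩, ?_⟩
    · refine Eq.trans (secEq_arrIso (a := a) hm hn rfl) ?_
      exact (arrIso_secEq (a := a) hm hn rfl).symm
    · rintro d ⟨k₁, k₂, k₃⟩
      refine loopArr_ext k₁ (arrIso_injective h.isTwoCartesian
        (hm := (congrArg (· ≫ G.loopPt) k₁).symm.trans (comp_loopArrow_s d))
        (hn := (comp_loopArrow_r d).trans (congrArg (· ≫ G.loopPt) k₂)) (hm' := hm) (hn' := hn) ?_)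
      rw [← cancel_epi (secEq a (congrArg (· ≫ G.loopPt) k₁)).hom]
      refine Eq.trans ?_ k₃.symm
      refine Eq.trans (secEq_arrIso _ _ _) ?_
      exact (arrIso_secEq (comp_loopArrow_s d) (comp_loopArrow_r d) _).symm
  arrow_comp := by
    intro U γ μ ν k hν x y z hx hy hy' hz hx' hz'
    refine Loop.hom_ext (C := X.obj (site _)) ?_
    refine (arrow_loopGroupoidSq h ν hx' hz').trans (Eq.trans ?_
      (congrArg₂ (fun f g => f ≫ g) (arrow_loopGroupoidSq h γ hx hy)
        (arrow_loopGroupoidSq h μ hy' hz)).symm)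
    refine h.arrIso_comp _ _ _ (fun t => ?_) (fun t => ?_) _ _ _ _ _ _
    · exact ((s_conjLoop (h := (γ t).2)).symm.trans
        (congrArg (fun ν : G.LoopSpace => G.s ν.1) (k t))).trans (μ t).2.symm
    · exact congrArg G.loopArrow (hν t)

end LoopAtlas

end TopGroupoid

end Orbispace

namespace Orbispace

/-! ## The loop prestack of a stack is a stack -/

section Descent

open Pseudofunctor

universe w

variable {X : Prestack.{u}} {ι : Type w} {S : TopCat.{u}} {U : ι → TopCat.{u}} {f : ∀ i, U i ⟶ S}

/-- The descent datum underlying a descent datum of loops. -/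
def descentPt (D : (loopStack X).DescentData f) : X.DescentData f where
  obj i := Loop.pt (C := X.obj (site (U i))) (D.obj i)
  hom Y q _ _ f₁ f₂ h₁ h₂ := Loop.Hom.hom (C := X.obj (site Y)) (D.hom q f₁ f₂ h₁ h₂)
  pullHom_hom Y' _ g q q' hq _ _ f₁ f₂ h₁ h₂ g₁ g₂ k₁ k₂ :=
    congrArg (Loop.Hom.hom (C := X.obj (site Y'))) (D.pullHom_hom g q q' hq f₁ f₂ h₁ h₂ g₁ g₂ k₁ k₂)
  hom_self _ q _ g h := congrArg (Loop.Hom.hom (C := X.obj (site _))) (D.hom_self q g h)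
  hom_comp Y q _ _ _ f₁ f₂ f₃ h₁ h₂ h₃ :=
    congrArg (Loop.Hom.hom (C := X.obj (site Y))) (D.hom_comp q f₁ f₂ f₃ h₁ h₂ h₃)

/-- The automorphism of the descent datum underlying a descent datum of loops. -/
def descentAut (D : (loopStack X).DescentData f) : descentPt D ≅ descentPt D :=
  DescentData.isoMk (fun i => Loop.aut (C := X.obj (site (U i))) (D.obj i))
    (fun Y q _ _ f₁ f₂ h₁ h₂ => Loop.Hom.comm (C := X.obj (site Y)) (D.hom q f₁ f₂ h₁ h₂))

/-- Morphisms of loops are glued in `X`, and their compatibility with automorphisms is checked after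
applying a faithful functor. For objects, the automorphisms in a descent datum form an automorphism
of the underlying datum, which full faithfulness carries to the glued object. -/
theorem isEquivalence_toDescentData_loopStack (h : (X.toDescentData f).IsEquivalence) :
    ((loopStack X).toDescentData f).IsEquivalence where
  faithful := ⟨fun {M N} φ ψ e => Loop.hom_ext (C := X.obj (site S))
    ((X.toDescentData f).map_injective (DescentData.hom_ext fun i =>
      congrArg (Loop.Hom.hom (C := X.obj (site (U i)))) (congrArg (fun k => k.hom i) e)))⟩
  full := ⟨fun {M N} g => by
    let g' : (X.toDescentData f).obj (Loop.pt (C := X.obj (site S)) M) ⟶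
        (X.toDescentData f).obj (Loop.pt (C := X.obj (site S)) N) :=
      { hom := fun i => Loop.Hom.hom (C := X.obj (site (U i))) (g.hom i)
        comm := fun Y q _ _ f₁ f₂ h₁ h₂ =>
          congrArg (Loop.Hom.hom (C := X.obj (site Y))) (g.comm q f₁ f₂ h₁ h₂) }
    obtain ⟨k, hk⟩ := (X.toDescentData f).map_surjective g'
    refine ⟨⟨k, (X.toDescentData f).map_injective ?_⟩, ?_⟩
    · rw [Functor.map_comp, Functor.map_comp, hk]
      ext i
      exact Loop.Hom.comm (C := X.obj (site (U i))) (g.hom i)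
    · ext i
      exact Loop.hom_ext (C := X.obj (site (U i))) (congrArg (fun k => k.hom i) hk)⟩
  essSurj := ⟨fun D => by
    let e := (X.toDescentData f).objObjPreimageIso (descentPt D)
    let α := (X.toDescentData f).preimageIso (e ≪≫ descentAut D ≪≫ e.symm)
    have hα : (X.toDescentData f).map α.hom ≫ e.hom = e.hom ≫ (descentAut D).hom := by
      simp [α]
    let ei (i : ι) := Functor.mapIso
      ({ obj := fun D => D.obj i, map := fun k => k.hom i } :
        X.DescentData f ⥤ X.obj (site (U i))) e
    refine ⟨(⟨_, α⟩ : Loop (X.obj (site S))), ⟨DescentData.isoMk (fun i =>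
      Loop.isoMk (C := X.obj (site (U i))) (ei i) (congrArg (fun k => k.hom i) hα)) ?_⟩⟩
    intro Y q _ _ f₁ f₂ h₁ h₂
    exact Loop.hom_ext (C := X.obj (site Y)) (e.hom.comm q f₁ f₂ h₁ h₂)⟩

theorem IsTopStack.loopStack (h : IsTopStack X) : IsTopStack (loopStack X) where
  isGroupoid U := by
    have := h.isGroupoid U
    exact ⟨fun {x y} k => (Loop.isoMk (C := X.obj (site U)) (@asIso _ _ _ _ k.hom (this.all_isIso _))
      k.comm).isIso_hom⟩
  isStack := by
    have := h.isStack
    refine IsStack.of_isStackFor fun S R hR => (isStackFor_iff _ _).2 ?_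
    exact isEquivalence_toDescentData_loopStack ((isStackFor_iff _ _).1 (X.isStackFor' R hR))

end Descent

end Orbispace

namespace Orbispace

/-! ## Locally representable sheaves on topological spaces -/

section LocallyRepresentable

theorem ofArrows_mem_grothendieckTopology {V : TopCat.{u}} {ι : Type*} {U : ι → TopCat.{u}}
    {f : ∀ i, U i ⟶ V} (hf : ∀ i, Topology.IsOpenEmbedding (f i))
    (hf' : ∀ v : V, ∃ i, v ∈ Set.range (f i)) :
    Sieve.ofArrows U f ∈ TopCat.grothendieckTopology.{u} V :=
  Precoverage.generate_mem_toGrothendieck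
    ⟨(Presieve.ofArrows_mem_comap_jointlySurjectivePrecoverage_iff _).2 hf',
      MorphismProperty.ofArrows_mem_precoverage.2 hf⟩

/-- The inclusion of a point. -/
def pointIncl {V : TopCat.{u}} (v : V) : TopCat.of PUnit.{u + 1} ⟶ V :=
  TopCat.ofHom (ContinuousMap.const _ v)

/-- The inclusion of a subspace. -/
def subIncl {V : TopCat.{u}} (N : Set V) : TopCat.of N ⟶ V :=
  TopCat.ofHom ⟨Subtype.val, continuous_subtype_val⟩

/-- The map to a subspace given by a map with values in it. -/
def subLift {V W : TopCat.{u}} {N : Set V} (f : W ⟶ V) (h : ∀ w, f w ∈ N) : W ⟶ TopCat.of N :=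
  TopCat.ofHom ⟨fun w => ⟨f w, h w⟩, f.hom.continuous.subtype_mk h⟩

theorem isOpenEmbedding_subIncl {V : TopCat.{u}} {N : Set V} (hN : IsOpen N) :
    Topology.IsOpenEmbedding (subIncl N) := hN.isOpenEmbedding_subtypeVal

/-- A presheaf on spaces satisfies descent for coverings by open embeddings. -/
def IsOpenSheaf (Q : TopCat.{u}ᵒᵖ ⥤ Type u) : Prop :=
  ∀ (V : TopCat.{u}) (ι : Type u) (U : ι → TopCat.{u}) (f : ∀ i, U i ⟶ V),
    (∀ i, Topology.IsOpenEmbedding (f i)) → (∀ v : V, ∃ i, v ∈ Set.range (f i)) →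
      (Presieve.ofArrows U f).IsSheafFor Q

variable {Q : TopCat.{u}ᵒᵖ ⥤ Type u} {T V W : TopCat.{u}}

/-- The set of points of a presheaf, with the final topology for all sections. -/
def PointSpace (Q : TopCat.{u}ᵒᵖ ⥤ Type u) : Type u := Q.obj (op (TopCat.of PUnit.{u + 1}))

/-- The map to the set of points given by a section. -/
def evalPoint (z : Q.obj (op V)) (v : V) : PointSpace Q := Q.map (pointIncl v).op z

theorem evalPoint_map (z : Q.obj (op V)) (g : W ⟶ V) (w : W) :
    evalPoint (Q.map g.op z) w = evalPoint z (g w) := by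
  have h : (pointIncl (g w)).op = g.op ≫ (pointIncl w).op := rfl
  rw [evalPoint, evalPoint, h, Functor.map_comp_apply]

instance : TopologicalSpace (PointSpace Q) where
  IsOpen S := ∀ (V : TopCat.{u}) (z : Q.obj (op V)), IsOpen (evalPoint z ⁻¹' S)
  isOpen_univ _ _ := isOpen_univ
  isOpen_inter _ _ h h' V z := (h V z).inter (h' V z)
  isOpen_sUnion S h V z := by
    rw [Set.preimage_sUnion]
    exact isOpen_biUnion fun s hs => h s hs V z

theorem continuous_evalPoint (z : Q.obj (op V)) : Continuous (evalPoint z) :=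
  ⟨fun _ hS => hS V z⟩

/-- The continuous map to the space of points given by a section. -/
def evalMap (z : Q.obj (op V)) : V ⟶ TopCat.of (PointSpace Q) :=
  TopCat.ofHom ⟨evalPoint z, continuous_evalPoint z⟩

variable {π : ∀ {V : TopCat.{u}}, Q.obj (op V) → (V ⟶ T)}

/-- A section which represents the sections lying over an open subset of the base. -/
structure IsChart (π : ∀ {V : TopCat.{u}}, Q.obj (op V) → (V ⟶ T)) (N : Set T) {L : TopCat.{u}}
    (l : Q.obj (op L)) : Prop where
  isOpen : IsOpen N
  mem (x : L) : π l x ∈ N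
  existsUnique {V : TopCat.{u}} (z : Q.obj (op V)) (hz : ∀ v, π z v ∈ N) :
    ∃! k : V ⟶ L, Q.map k.op l = z

section

variable (hπ : ∀ {V W : TopCat.{u}} (g : W ⟶ V) (z : Q.obj (op V)), π (Q.map g.op z) = g ≫ π z)

include hπ

variable {N : Set T} {L : TopCat.{u}} {l : Q.obj (op L)}

/-- Points of `L` are maps from the one-point space, and such a map is determined by the section it
classifies. -/
theorem IsChart.injective (h : IsChart π N l) : Function.Injective (evalPoint l) := by
  intro x y hxy
  have := (h.existsUnique (Q.map (pointIncl x).op l)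
    (fun v => by rw [hπ]; exact h.mem _)).unique (y₁ := pointIncl x) (y₂ := pointIncl y) rfl hxy.symm
  exact congrArg (fun k : TopCat.of PUnit.{u + 1} ⟶ L => k PUnit.unit) this

/-- In the final topology, openness of the image of `O` is tested by pulling back along each section
`z`. This preimage lies over `N`, and there `z` is classified by a map `k` to `L`, so it is the
preimage of `O` under `k`. -/
theorem IsChart.isOpenEmbedding (h : IsChart π N l) : Topology.IsOpenEmbedding (evalMap l) := by
  refine .of_continuous_injective_isOpenMap (continuous_evalPoint l) (h.injective hπ) ?_
  intro O hO V z
  let M : Set V := π z ⁻¹' N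
  have hM : IsOpen M := h.isOpen.preimage (π z).hom.continuous
  obtain ⟨k, hk, -⟩ := h.existsUnique (Q.map (subIncl M).op z)
    (fun v => by rw [hπ]; exact v.2)
  have hv (v : TopCat.of M) : evalPoint z v.1 = evalPoint l (k v) := by
    rw [← evalPoint_map, hk, evalPoint_map]
    rfl
  have : evalPoint z ⁻¹' (evalMap l '' O) = Subtype.val '' (k ⁻¹' O) := by
    ext v
    constructor
    · rintro ⟨x, hx, e⟩
      have hvM : v ∈ M := by
        have h₁ : π (evalPoint l x) = π (evalPoint z v) := congrArg π e
        rw [evalPoint, evalPoint, hπ, hπ] at h₁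
        have h₂ := congrArg (fun k : TopCat.of PUnit.{u + 1} ⟶ T => k PUnit.unit) h₁
        change N (π z v)
        rw [← show π l x = π z v from h₂]
        exact h.mem x
      refine ⟨⟨v, hvM⟩, ?_, rfl⟩
      have := h.injective hπ (e.trans (hv ⟨v, hvM⟩))
      change k ⟨v, hvM⟩ ∈ O
      rwa [← this]
    · rintro ⟨w, hw, rfl⟩
      exact ⟨k w, hw, (hv w).symm⟩
  rw [this]
  exact hM.isOpenMap_subtype_val _ (hO.preimage k.hom.continuous)

/-- Points determine the base map and hence the open sets of `V` lying over charts. On each of these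
both sections are classified by maps to the chart, which agree by `IsChart.injective`; the sheaf
property concludes. -/
theorem ext_evalPoint (hQ : IsOpenSheaf Q)
    (hloc : ∀ x : T, ∃ (N : Set T) (L : TopCat.{u}) (l : Q.obj (op L)), x ∈ N ∧ IsChart π N l)
    {z z' : Q.obj (op V)} (h : ∀ v, evalPoint z v = evalPoint z' v) : z = z' := by
  have hzz : π z = π z' := by
    ext v
    have h₁ := congrArg π (h v)
    rw [evalPoint, evalPoint, hπ, hπ] at h₁
    exact congrArg (fun k : TopCat.of PUnit.{u + 1} ⟶ T => k PUnit.unit) h₁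
  choose N L l hx hl using hloc
  let M (v : V) : Set V := π z ⁻¹' N (π z v)
  refine (hQ V V (fun v => TopCat.of (M v)) (fun v => subIncl (M v))
    (fun v => isOpenEmbedding_subIncl ((hl _).isOpen.preimage (π z).hom.continuous))
    (fun v => ⟨v, ⟨v, hx _⟩, rfl⟩)).isSeparatedFor.ext ?_
  rintro _ _ ⟨v⟩
  obtain ⟨k, hk, -⟩ := (hl (π z v)).existsUnique (Q.map (subIncl (M v)).op z)
    (fun w => by rw [hπ]; exact w.2)
  obtain ⟨k', hk', -⟩ := (hl (π z v)).existsUnique (Q.map (subIncl (M v)).op z')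
    (fun w => by rw [hπ, ← hzz]; exact w.2)
  have hkk : k = k' := by
    ext w
    refine (hl (π z v)).injective hπ ?_
    rw [← evalPoint_map, ← evalPoint_map, hk, hk', evalPoint_map, evalPoint_map, h]
  rw [← hk, ← hk', hkk]

/-- A sheaf on spaces which is representable locally over a space is representable. -/
theorem exists_universal (hQ : IsOpenSheaf Q)
    (hloc : ∀ x : T, ∃ (N : Set T) (L : TopCat.{u}) (l : Q.obj (op L)), x ∈ N ∧ IsChart π N l) :
    ∃ (Z : TopCat.{u}) (ζ : Q.obj (op Z)), ∀ (V : TopCat.{u}) (z : Q.obj (op V)),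
      ∃! k : V ⟶ Z, Q.map k.op ζ = z := by
  have hsep {V : TopCat.{u}} {z z' : Q.obj (op V)} (h : ∀ v, evalPoint z v = evalPoint z' v) :
      z = z' := ext_evalPoint hπ hQ hloc h
  choose N L l hx hl using hloc
  -- An element of `PointSpace Q` is itself a section over the one-point space, so a chart around
  -- its base point classifies it.
  have hcov (ω : PointSpace Q) : ∃ x y, evalPoint (l x) y = ω := by
    let x := π ω PUnit.unit
    obtain ⟨k, hk, -⟩ := (hl x).existsUnique ω (fun v => hx x)
    exact ⟨x, k PUnit.unit, hk⟩
  -- The charts form an open cover of `PointSpace Q`, and their sections agree on overlaps since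
  -- they agree on points. They glue to the universal section.
  obtain ⟨ζ, hζ, -⟩ := (Presieve.isSheafFor_arrows_iff _ _).1
    (hQ (TopCat.of (PointSpace Q)) T L (fun x => evalMap (l x))
      (fun x => (hl x).isOpenEmbedding hπ)
      (fun ω => (hcov ω).imp fun x h => h)) l (by
        intro i j Z gi gj h
        refine hsep fun v => ?_
        rw [evalPoint_map, evalPoint_map]
        exact congrArg (fun k : Z ⟶ TopCat.of (PointSpace Q) => k v) h)
  have hev (ω : PointSpace Q) : evalPoint (V := TopCat.of (PointSpace Q)) ζ ω = ω := by
    obtain ⟨x, y, rfl⟩ := hcov ω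
    have := evalPoint_map ζ (evalMap (l x)) y
    rw [hζ] at this
    exact this.symm
  refine ⟨TopCat.of (PointSpace Q), ζ, fun V z => ⟨evalMap z, hsep fun v => ?_, ?_⟩⟩
  · rw [evalPoint_map, hev]
    rfl
  · rintro k rfl
    ext v
    exact (hev _).symm.trans (evalPoint_map ζ k v).symm

end

end LocallyRepresentable

end Orbispace

namespace Orbispace

/-! ## The sheaf of endomorphisms of a family -/

section Endomorphisms

open Pseudofunctor LocallyDiscreteOpToCat

variable {X : Prestack.{u}} {T U V W Y : TopCat.{u}}

/-- Equality of pairs becomes a commuting square, avoiding heterogeneous equality. -/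
theorem endo_ext {t : space T ⟶ X} {z z' : Σ p : V ⟶ T, (sec t p ⟶ sec t p)} :
    z = z' ↔ ∃ h : z.1 = z'.1, z.2 ≫ (secEq t h).hom = (secEq t h).hom ≫ z'.2 := by
  obtain ⟨p, φ⟩ := z
  obtain ⟨p', φ'⟩ := z'
  constructor
  · rintro h
    cases h
    exact ⟨rfl, by simp⟩
  · rintro ⟨h, e⟩
    dsimp only at h
    subst h
    simp only [secEq_rfl, Iso.refl_hom, Category.comp_id, Category.id_comp] at e
    rw [e]

/-- The presheaf of endomorphisms of the members of a family. -/
def endo (t : space T ⟶ X) : TopCat.{u}ᵒᵖ ⥤ Type u where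
  obj V := Σ p : V.unop ⟶ T, (sec t p ⟶ sec t p)
  map g := ↾fun z => ⟨g.unop ≫ z.1, res g.unop rfl rfl z.2⟩
  map_id V := by
    apply ConcreteCategory.hom_ext
    intro z
    have h : res (𝟙 V.unop) rfl rfl z.2 = z.2 := by
      have key {C : Type (u + 1)} [Category.{u} C] {A : C} (b : A ≅ A) (α : A ⟶ A)
          (hb : b = Iso.refl _) : b.hom ≫ α ≫ b.inv = α := by
        simp [hb]
      exact (res_one rfl rfl z.2).trans (key _ _ (secEq_rfl t rfl))
    exact Sigma.ext rfl (heq_of_eq h)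
  map_comp g h := by
    apply ConcreteCategory.hom_ext
    intro z
    exact Sigma.ext rfl (heq_of_eq (res_res g.unop h.unop rfl rfl rfl rfl z.2).symm)

/-- The base point of a section of the presheaf of endomorphisms. -/
def endoBase (t : space T ⟶ X) {V : TopCat.{u}} (z : (endo t).obj (op V)) : V ⟶ T := z.1

theorem eq_endo_map_iff {t : space T ⟶ X} {g : W ⟶ V} {p : V ⟶ T} {φ : sec t p ⟶ sec t p}
    {n : W ⟶ T} {ψ : sec t n ⟶ sec t n} :
    (endo t).map g.op ⟨p, φ⟩ = ⟨n, ψ⟩ ↔ ∃ h : n = g ≫ p, res g h h φ = ψ := by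
  constructor
  · intro e
    cases e
    exact ⟨rfl, rfl⟩
  · rintro ⟨rfl, rfl⟩
    rfl

/-- Endomorphisms of the members of a family as sections of the presheaf of endomorphisms. -/
def endoEquiv (t : space T ⟶ X) (y : Y ⟶ V) (p : V ⟶ T) :
    (sec t (y ≫ p) ⟶ sec t (y ≫ p)) ≃
      ((X.presheafHom (sec t p) (sec t p)).obj (op (Over.mk y))) :=
  Iso.homCongr (secNat t y rfl) (secNat t y rfl)

/-- Identifies restriction in the presheaf of morphisms with `res`; the coherence needed is
`secNat_comp`. -/
theorem pullHom_endoEquiv (t : space T ⟶ X) (p : V ⟶ T) (y : Y ⟶ V) (g : W ⟶ Y) (y' : W ⟶ V)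
    (h : g ≫ y = y') (h' : y' ≫ p = g ≫ y ≫ p) (φ : sec t (y ≫ p) ⟶ sec t (y ≫ p)) :
    pullHom (endoEquiv t y p φ) g y' y' h h =
      endoEquiv t y' p (res g h' h' φ) := by
  subst h
  have h1 := secNat_comp (f := t) y g (m := p) rfl rfl rfl
  have h2 := res_secNat g h' h' φ
  have key {C D : Type (u + 1)} [Category.{u} C] [Category.{u} D] (H : D ⥤ C) {A P : C}
      {A' Q : D} (s : A ≅ P) (c : P ≅ H.obj Q) (e : A ≅ H.obj A')
      (w : A' ≅ Q) (φ : A' ⟶ A') (ρ : A ⟶ A) (h1 : s.hom ≫ c.hom = e.hom ≫ H.map w.hom)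
      (h2 : ρ ≫ e.hom = e.hom ≫ H.map φ) :
      c.hom ≫ H.map (w.inv ≫ φ ≫ w.hom) ≫ c.inv = s.inv ≫ ρ ≫ s.hom := by
    rw [← cancel_epi s.hom, ← cancel_mono c.hom]
    simp only [Category.assoc, Iso.inv_hom_id, Category.comp_id, Iso.hom_inv_id_assoc]
    rw [h1, reassoc_of% h2, reassoc_of% h1, ← H.map_comp, ← H.map_comp, Iso.hom_inv_id_assoc]
  refine Eq.trans ?_ (key (X.map g.op.toLoc).toFunctor _
    ((Cat.Hom.toNatIso (X.mapComp y.op.toLoc g.op.toLoc)).app (sec t p)) _ _ φ _ h1 h2)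
  have e : X.mapComp' y.op.toLoc g.op.toLoc (g ≫ y).op.toLoc rfl =
    X.mapComp y.op.toLoc g.op.toLoc := X.mapComp'_eq_mapComp _ _
  exact congrArg (fun c => c.hom.toNatTrans.app (sec t p) ≫
    (X.map g.op.toLoc).toFunctor.map (endoEquiv t y p φ) ≫ c.inv.toNatTrans.app (sec t p)) e

theorem isSheafFor_yoneda {ι : Type u} {U : ι → TopCat.{u}} {f : ∀ i, U i ⟶ V}
    (h : Sieve.ofArrows U f ∈ TopCat.grothendieckTopology.{u} V) (T : TopCat.{u}) :
    (Presieve.ofArrows U f).IsSheafFor (yoneda.obj T) := by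
  rw [Presieve.isSheafFor_iff_generate]
  exact GrothendieckTopology.Subcanonical.isSheaf_of_isRepresentable
    (J := TopCat.grothendieckTopology.{u}) (yoneda.obj T) _ h

/-- The sheaf condition for morphisms is the full faithfulness of the comparison with descent data.
-/
theorem isSheafFor_presheafHom (hX : IsTopStack X) {ι : Type u} {U : ι → TopCat.{u}}
    {f : ∀ i, U i ⟶ V} (h : Sieve.ofArrows U f ∈ TopCat.grothendieckTopology.{u} V)
    (M N : X.obj (site V)) :
    (Presieve.ofArrows (fun i => Over.mk (f i)) (fun i => Over.homMk (V := Over.mk (𝟙 V))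
      (f i))).IsSheafFor (X.presheafHom M N) := by
  have := hX.isStack
  have := X.isEquivalence_toDescentData f h
  exact (bijective_toDescentData_map_iff f M N).1
    ((Functor.FullyFaithful.ofFullyFaithful (X.toDescentData f)).map_bijective M N)

/-- The base maps glue because represented presheaves are sheaves. Over the glued map `p` the
endomorphisms are sections of the presheaf of morphisms, so they glue by descent. -/
theorem isOpenSheaf_endo (hX : IsTopStack X) (t : space T ⟶ X) : IsOpenSheaf (endo t) := by
  intro V ι U f hf hf'
  have hJ := ofArrows_mem_grothendieckTopology hf hf'
  rw [Presieve.isSheafFor_arrows_iff]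
  intro x hx
  have hT := (Presieve.isSheafFor_arrows_iff _ _).1 (isSheafFor_yoneda hJ T)
  obtain ⟨p, hp, hp'⟩ := hT (fun i => (x i).1)
    (fun i j Z gi gj h => congrArg Sigma.fst (hx i j Z gi gj h))
  have hxφ (i : ι) : ∃ φ : sec t (f i ≫ p) ⟶ sec t (f i ≫ p), x i = ⟨f i ≫ p, φ⟩ := by
    have hpi : f i ≫ p = (x i).1 := hp i
    rw [hpi]
    exact ⟨(x i).2, rfl⟩
  choose φ hφ using hxφ
  obtain ⟨τ, hτ, hτ'⟩ := (Presieve.isSheafFor_arrows_iff _ _).1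
    (isSheafFor_presheafHom hX hJ (sec t p) (sec t p)) (fun i => endoEquiv t (f i) p (φ i)) (by
      intro i j Z gi gj h
      have hgi : Z.hom ≫ p = gi.left ≫ f i ≫ p := by rw [← Over.w gi]; rfl
      have hgj : Z.hom ≫ p = gj.left ≫ f j ≫ p := by rw [← Over.w gj]; rfl
      have e := hx i j Z.left gi.left gj.left ((Over.w gi).trans (Over.w gj).symm)
      rw [hφ, hφ, (eq_endo_map_iff (g := gi.left)).2 ⟨hgi, rfl⟩] at e
      obtain ⟨_, e⟩ := eq_endo_map_iff.1 e.symm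
      refine (pullHom_endoEquiv t p (f i) gi.left Z.hom (Over.w gi) hgi (φ i)).trans ?_
      refine Eq.trans ?_ (pullHom_endoEquiv t p (f j) gj.left Z.hom (Over.w gj) hgj (φ j)).symm
      rw [e])
  -- The glued section lives over the object `𝟙 V` of the slice, so its base map appears as `𝟙 V ≫
  -- p`.
  obtain ⟨ψ, rfl⟩ := (endoEquiv t (𝟙 V) p).surjective τ
  have aux (ψ' : sec t (𝟙 V ≫ p) ⟶ sec t (𝟙 V ≫ p)) (i : ι) :
      (X.presheafHom (sec t p) (sec t p)).map (Over.homMk (U := Over.mk (f i))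
        (V := Over.mk (𝟙 V)) (f i)).op (endoEquiv t (𝟙 V) p ψ') = endoEquiv t (f i) p (φ i) ↔
      (endo t).map (f i).op ⟨𝟙 V ≫ p, ψ'⟩ = x i := by
    rw [hφ, eq_endo_map_iff]
    refine Iff.trans (Eq.congr_left (pullHom_endoEquiv t p (𝟙 V) (f i) (f i) rfl rfl ψ')) ?_
    rw [(endoEquiv t (f i) p).apply_eq_iff_eq]
    exact ⟨fun h => ⟨rfl, h⟩, fun h => h.2⟩
  refine ⟨⟨𝟙 V ≫ p, ψ⟩, fun i => (aux ψ i).1 (hτ i), ?_⟩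
  rintro ⟨p', ψ'⟩ h
  obtain rfl : p' = p := hp' p' fun i => congrArg Sigma.fst (h i)
  have := hτ' (endoEquiv t (𝟙 V) p' ψ') fun i => (aux ψ' i).2 (h i)
  rw [← (endoEquiv t (𝟙 V) p').injective this]
  rfl

end Endomorphisms

end Orbispace

namespace Orbispace

/-! ## Representability of the projection of the loop stack -/

section Chart

namespace TopGroupoid

variable {G : TopGroupoid.{u}} {X : Prestack.{u}} {a : space G.Obj ⟶ X} {T M V W : TopCat.{u}}
  {t : space T ⟶ X} {i : M ⟶ T} {y : M ⟶ G.Obj}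

/-- The endomorphism of a family which corresponds to a family of loops under an isomorphism of the
family with a pull-back from the atlas. -/
def chartEnd (θ : spaceMap G.s ≫ a ≅ spaceMap G.r ≫ a) (ψ : sec t i ≅ sec a y) (p : V ⟶ M)
    (z : V ⟶ G.loopGroupoid.Obj) (h : p ≫ y = z ≫ G.loopPt) :
    sec t (p ≫ i) ⟶ sec t (p ≫ i) :=
  res p rfl rfl ψ.hom ≫ (secEq a h).hom ≫ (loopArr θ V z).hom ≫ (secEq a h.symm).hom ≫
    res p rfl rfl ψ.inv

variable {θ : spaceMap G.s ≫ a ≅ spaceMap G.r ≫ a} {ψ : sec t i ≅ sec a y}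

theorem res_chartEnd (g : W ⟶ V) (p : V ⟶ M) (z : V ⟶ G.loopGroupoid.Obj)
    (h : p ≫ y = z ≫ G.loopPt) (h' : (g ≫ p) ≫ i = g ≫ p ≫ i) :
    res g h' h' (chartEnd θ ψ p z h) =
      chartEnd θ ψ (g ≫ p) (g ≫ z) (congrArg (fun k => g ≫ k) h) := by
  have h₁ : (g ≫ p) ≫ y = g ≫ p ≫ y := Category.assoc _ _ _
  have h₂ : (g ≫ z) ≫ G.loopPt = g ≫ z ≫ G.loopPt := Category.assoc _ _ _
  rw [chartEnd, res_comp g h' h₁ h', res_comp g h₁ h₂ h', res_comp g h₂ h₂ h', res_comp g h₂ h₁ h',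
    res_res, res_res, res_secEq, res_secEq, res_loopArr]
  rfl

/-- Conjugating `φ` by the restriction of `ψ` gives an automorphism of a member of the atlas family,
which a family of loops represents. -/
theorem exists_chartEnd (hθ : IsTwoCartesian θ) (ψ : sec t i ≅ sec a y) (p : V ⟶ M)
    (φ : sec t (p ≫ i) ⟶ sec t (p ≫ i)) [IsIso φ] :
    ∃ (z : V ⟶ G.loopGroupoid.Obj) (h : p ≫ y = z ≫ G.loopPt), chartEnd θ ψ p z h = φ := by
  let e := resIso p rfl rfl ψ
  obtain ⟨z, h, hz⟩ := exists_loopArr hθ (e.symm ≪≫ asIso φ ≪≫ e)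
  refine ⟨z, h, ?_⟩
  rw [chartEnd, ← reassoc_of% hz, secEq_trans_assoc, secEq_rfl]
  simp only [Iso.trans_hom, Iso.symm_hom, Iso.refl_hom, Category.id_comp, Category.assoc,
    asIso_hom]
  have h₁ : res p rfl rfl ψ.hom ≫ e.inv = 𝟙 _ := e.hom_inv_id
  have h₂ : e.hom ≫ res p rfl rfl ψ.inv = 𝟙 _ := e.hom_inv_id
  rw [reassoc_of% h₁, h₂, Category.comp_id]

theorem chartEnd_injective (hθ : IsTwoCartesian θ) {p : V ⟶ M} {z z' : V ⟶ G.loopGroupoid.Obj}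
    {h : p ≫ y = z ≫ G.loopPt} {h' : p ≫ y = z' ≫ G.loopPt}
    (e : chartEnd θ ψ p z h = chartEnd θ ψ p z' h') : z = z' := by
  have i₁ : IsIso (res p rfl rfl ψ.hom) := (resIso p rfl rfl ψ).isIso_hom
  have i₂ : IsIso (res p rfl rfl ψ.inv) := (resIso p rfl rfl ψ).isIso_inv
  rw [chartEnd, chartEnd, cancel_epi, ← Category.assoc, ← Category.assoc, ← Category.assoc,
    ← Category.assoc, cancel_mono, ← cancel_epi (secEq a h.symm).hom,
    ← cancel_mono (secEq a h').hom] at e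
  simp only [Category.assoc, secEq_trans, secEq_trans_assoc, secEq_rfl, Iso.refl_hom,
    Category.comp_id, Category.id_comp] at e
  exact eq_of_loopArr hθ (h.symm.trans h') e

/-- The fibre product of the base of a chart and the space of loops. -/
abbrev ChartSpace (y : M ⟶ G.Obj) : Type u :=
  {c : M × G.loopGroupoid.Obj // y c.1 = G.loopPt c.2}

/-- The chart is the fibre product of `N` and the space of loops over `G.Obj`. Endomorphisms are
invertible, since `X` has groupoids as values, so each corresponds under `ψ` to a unique family of
loops. -/
theorem exists_isChart (hX : IsTopStack X) (hθ : IsTwoCartesian θ) {N : Set T} (hN : IsOpen N)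
    {y : TopCat.of N ⟶ G.Obj} (ψ : sec t (subIncl N) ≅ sec a y) :
    ∃ (L : TopCat.{u}) (l : (endo t).obj (op L)), IsChart (endoBase t) N l := by
  have := hX.isGroupoid
  let q₁ : TopCat.of (ChartSpace y) ⟶ TopCat.of N :=
    TopCat.ofHom ⟨fun c => c.1.1, continuous_fst.comp continuous_subtype_val⟩
  let q₂ : TopCat.of (ChartSpace y) ⟶ G.loopGroupoid.Obj :=
    TopCat.ofHom ⟨fun c => c.1.2, continuous_snd.comp continuous_subtype_val⟩
  have hq : q₁ ≫ y = q₂ ≫ G.loopPt := by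
    ext c
    exact c.2
  refine ⟨TopCat.of (ChartSpace y), ⟨q₁ ≫ subIncl N, chartEnd θ ψ q₁ q₂ hq⟩, hN,
    fun c => (q₁ c).2, ?_⟩
  rintro V ⟨p, φ⟩ hz
  obtain ⟨p, rfl⟩ : ∃ p' : V ⟶ TopCat.of N, p = p' ≫ subIncl N := ⟨subLift p hz, rfl⟩
  obtain ⟨z, h, rfl⟩ := exists_chartEnd hθ ψ p φ
  refine ⟨TopCat.ofHom ⟨fun v => ⟨(p v, z v), congrArg (fun k : V ⟶ G.Obj => k v) h⟩,
    (p.hom.continuous.prodMk z.hom.continuous).subtype_mk _⟩, ?_, ?_⟩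
  · exact eq_endo_map_iff.2 ⟨rfl, res_chartEnd _ q₁ q₂ hq rfl⟩
  · intro k hk
    obtain ⟨e, hk⟩ := eq_endo_map_iff.1 hk
    obtain rfl : p = k ≫ q₁ := by
      ext v
      exact congrArg (fun m : V ⟶ T => m v) e
    obtain rfl : z = k ≫ q₂ :=
      (chartEnd_injective hθ ((res_chartEnd k q₁ q₂ hq rfl).symm.trans hk)).symm
    rfl

end TopGroupoid

/-- A local section of the projection from the fibre product of `T` and `A` to `T` gives a map to
`A` along which `t` is locally a pull-back. -/
theorem IsAtlas.exists_chart {A T : TopCat.{u}} {X : Prestack.{u}} {a : space A ⟶ X}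
    (ha : IsAtlas a) (t : space T ⟶ X) (x : T) :
    ∃ (N : Set T) (y : TopCat.of N ⟶ A), IsOpen N ∧ x ∈ N ∧
      Nonempty (sec t (subIncl N) ≅ sec a y) := by
  obtain ⟨Z, p, q, κ, hκ⟩ := ha.representable T t
  obtain ⟨N, hN, hx, σ, hσ⟩ := ha.localSections κ hκ x (ha.surjective κ hκ x)
  have h : subIncl N = TopCat.ofHom σ ≫ p := by
    ext w
    exact (hσ w).symm
  exact ⟨N, pt q (TopCat.ofHom σ), hN, hx, ⟨secEq t h ≪≫ sqIso κ (TopCat.ofHom σ)⟩⟩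

end Chart

section Projection

variable {X : Prestack.{u}} {T Z : TopCat.{u}}

/-- As `X` has groupoids as values, the universal endomorphism is an automorphism and defines a
family of loops over `Z`. The square it forms commutes by an identity cell. -/
theorem isRepresentable_loopProjection_of_universal (hX : IsTopStack X)
    (h : ∀ (T : TopCat.{u}) (t : space T ⟶ X), ∃ (Z : TopCat.{u}) (ζ : (endo t).obj (op Z)),
      ∀ (V : TopCat.{u}) (z : (endo t).obj (op V)), ∃! k : V ⟶ Z, (endo t).map k.op ζ = z) :
    IsRepresentable (loopProjection X) := by
  intro T t
  have := hX.isGroupoid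
  obtain ⟨Z, ⟨p, φ⟩, hζ⟩ := h T t
  let e (U : TopCat.{u}) (z : U ⟶ Z) : sec t (z ≫ p) ≅ sec t (z ≫ p) := resIso z rfl rfl (asIso φ)
  have he {U V : TopCat.{u}} (g : V ⟶ U) (z : U ⟶ Z) :
      res g (Category.assoc g z p) (Category.assoc g z p) (e U z).hom = (e V (g ≫ z)).hom :=
    res_res z g rfl rfl _ _ φ
  let θ : spaceMap p ≫ t ≅ loopLift p t e he ≫ loopProjection X :=
    spaceIsoMk (fun U z => Iso.refl (sec t (z ≫ p))) (fun g z => by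
      refine (res_iff _ _ _ _ _).2 ?_
      rw [secNat_base, secNat_loopLift, secNat_spaceMap_comp]
      exact (Category.id_comp _).trans ((congrArg _ ((X.map g.op.toLoc).toFunctor.map_id _)).trans
        (Category.comp_id _)).symm)
  refine ⟨Z, p, loopLift p t e he, θ, fun U => ?_⟩
  refine { faithful := ⟨fun _ => Points.hom_subsingleton _ _ _ _⟩, full := ⟨?_⟩, essSurj := ⟨?_⟩ }
  · rintro ⟨y⟩ ⟨z⟩ k
    have h₁ : y ≫ p = z ≫ p := k.fst.down.down
    have h₂ : Loop.Hom.hom (C := X.obj (site U)) k.snd = (secEq t h₁).hom :=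
      (Category.id_comp _).symm.trans (k.w.symm.trans (Category.comp_id _))
    have h₃ : (e U y).hom ≫ (secEq t h₁).hom = (secEq t h₁).hom ≫ (e U z).hom := by
      rw [← h₂]
      exact Loop.Hom.comm (C := X.obj (site U)) k.snd
    have h₄ : y = z := (hζ U ((endo t).map z.op ⟨p, φ⟩)).unique (endo_ext.2 ⟨h₁, h₃⟩) rfl
    refine ⟨Points.homMk h₄, ?_⟩
    apply CategoricalPullback.Hom.ext
    · exact Points.hom_subsingleton _ _ _ _
    · exact Loop.hom_ext (C := X.obj (site U)) h₂.symm
  · rintro ⟨⟨m⟩, (n : Loop (X.obj (site U))), (ψ : sec t m ≅ n.pt)⟩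
    -- The automorphism of the loop `n` is transported along `ψ` to the member of `t` at `m`, and
    -- the universal property classifies the result.
    obtain ⟨z, hz, -⟩ := hζ U ⟨m, ψ.hom ≫ n.aut.hom ≫ ψ.inv⟩
    obtain ⟨h₁, h₂⟩ := endo_ext.1 hz
    refine ⟨⟨z⟩, ⟨CategoricalPullback.mkIso (Points.isoMk h₁)
      (Loop.isoMk (C := X.obj (site U)) (secEq t h₁ ≪≫ ψ) ?_) ?_⟩⟩
    · have key {C : Type (u + 1)} [Category.{u} C] {A B D : C} (f : A ⟶ A) (s : A ≅ B) (ψ : B ≅ D)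
          (n : D ≅ D) (h : f ≫ s.hom = s.hom ≫ ψ.hom ≫ n.hom ≫ ψ.inv) :
          f ≫ (s ≪≫ ψ).hom = (s ≪≫ ψ).hom ≫ n.hom := by
        rw [Iso.trans_hom, reassoc_of% h, Iso.inv_hom_id, Category.comp_id, Category.assoc]
      exact key _ _ _ _ h₂
    · exact (Category.id_comp _).symm

/-- The projection of the loop stack of a stack with an atlas is representable. -/
theorem isRepresentable_loopProjection {G : TopGroupoid.{u}} {a : space G.Obj ⟶ X}
    {θ : spaceMap G.s ≫ a ≅ spaceMap G.r ≫ a} (hX : IsTopStack X) (ha : IsAtlas a)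
    (hθ : IsTwoCartesian θ) : IsRepresentable (loopProjection X) := by
  refine isRepresentable_loopProjection_of_universal hX fun T t => ?_
  refine exists_universal (π := endoBase t) (fun _ _ => rfl) (isOpenSheaf_endo hX t) fun x => ?_
  obtain ⟨N, y, hN, hx, ⟨ψ⟩⟩ := ha.exists_chart t x
  obtain ⟨L, l, hl⟩ := TopGroupoid.exists_isChart hX hθ hN ψ
  exact ⟨N, L, l, hx, hl⟩

end Projection

/-- The loop stack of an orbispace is an orbispace. -/
theorem IsOrbispace.loopStack {X : Prestack.{u}} (hX : IsOrbispace X) :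
    IsOrbispace (loopStack X) := by
  obtain ⟨hS, G, a, ⟨hA, ⟨θ, hθ⟩, hP, hE, hG⟩⟩ := hX
  exact ⟨hS.loopStack, G.loopGroupoid, TopGroupoid.loopAtlas θ,
    TopGroupoid.loopAtlas_isAtlas hθ.isTwoCartesian hA,
    ⟨TopGroupoid.loopGroupoidSq hθ, TopGroupoid.loopGroupoid_isGroupoidOf hθ⟩,
    hP.loopGroupoid hG, hE.loopGroupoid, hG.loopGroupoid⟩

/-- The projection of the loop stack of an orbispace is representable. -/
theorem IsOrbispace.isRepresentable_loopProjection {X : Prestack.{u}} (hX : IsOrbispace X) :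
    IsRepresentable (loopProjection X) := by
  obtain ⟨hS, G, a, ⟨hA, ⟨θ, hθ⟩, -, -, -⟩⟩ := hX
  exact Orbispace.isRepresentable_loopProjection hS hA hθ.isTwoCartesian

end Orbispace

theorem mainTheorem3 (X : Orbispace.Prestack.{u}) (hX : Orbispace.IsOrbispace X) :
    Orbispace.IsOrbispace (Orbispace.loopStack X) ∧
      Orbispace.IsOrbispaceMorphism (Orbispace.loopProjection X) :=
  ⟨hX.loopStack, hX.loopStack, hX, hX.isRepresentable_loopProjection⟩
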